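/- Let $k$ be an algebraically closed field of characteristic $0$ and let $E$ be an elliptic curve over $k$. The degree of a non-zero rational function on $E$ is the number of its zeros, counted with multiplicities; a rational function on $E$ is also regarded as a morphism $E\to\mathbb P^1$, with value $\infty$ at its poles. Let $\alpha,\beta,\gamma,\delta$ be four pairwise distinct points of $E$ and let $a,b,c,d$ be four pairwise distinct points of $\mathbb P^1(k)$. Then there is a rational function $f$ on $E$ of degree $2$ such that $f(\alpha)=a$, $f(\beta)=b$, $f(\gamma)=c$ and $f(\delta)=d$. -/

import Mathlib

open scoped LinearAlgebra.Projectivization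

namespace EllipticFunction

open MvPolynomial

noncomputable section

variable {k : Type*} [Field k] (E : WeierstrassCurve.Affine k)

/-- Homogeneous coordinates in the projective plane of a point of `E`:
`[0 : 1 : 0]` for the point at infinity and `[x : y : 1]` for an affine point `(x, y)`. -/
def homCoords {E : WeierstrassCurve.Affine k} : E.Point → Fin 3 → k
  | .zero => ![0, 1, 0]
  | .some x y _ => ![x, y, 1]

/-- The triple `(x, y, 1)` of rational functions on `E`, where `x` and `y` are the affine
coordinate functions: the generic point of `E` in homogeneous coordinates. -/
def genericCoords : Fin 3 → E.FunctionField :=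
  ![algebraMap E.CoordinateRing E.FunctionField
      (WeierstrassCurve.Affine.CoordinateRing.mk E (Polynomial.C Polynomial.X)),
    algebraMap E.CoordinateRing E.FunctionField
      (WeierstrassCurve.Affine.CoordinateRing.mk E Polynomial.X), 1]

variable {E}

/-- The rational function `f` on `E` is the quotient `F / G` of two homogeneous polynomials
in three variables (homogeneous coordinates of the plane) of the same degree `n`. The definitions
below use this only for `F`, `G` not both zero at some point of `E`; then `G` is not identically
zero on `E` as soon as `f * G = F` holds on `E`. -/
def IsQuotient (f : E.FunctionField) (n : ℕ) (F G : MvPolynomial (Fin 3) k) : Prop :=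
  F.IsHomogeneous n ∧ G.IsHomogeneous n ∧
    f * aeval (genericCoords E) G = aeval (genericCoords E) F

/-- `f(P) = a` for a rational function `f` on `E`, regarded as a map to the projective line:
`f` can be written as `F / G` near `P`, with `F(P)`, `G(P)` not both zero and
`a = [F(P) : G(P)]`. The point `[u : v]` of the projective line is the value `u / v`; in
particular `[1 : 0]` is the value `∞` taken at the poles. -/
def HasValueAt (f : E.FunctionField) (P : E.Point) (a : ℙ k (Fin 2 → k)) : Prop :=
  ∃ (n : ℕ) (F G : MvPolynomial (Fin 3) k), IsQuotient f n F G ∧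
    ∃ h : ![eval (homCoords P) F, eval (homCoords P) G] ≠ 0, Projectivization.mk k _ h = a

/-- The local ring of `E` at `P`: the rational functions on `E` that are regular at `P`. -/
def localRing (P : E.Point) : Subring E.FunctionField where
  carrier := {f | ∃ (n : ℕ) (F G : MvPolynomial (Fin 3) k), IsQuotient f n F G ∧
    eval (homCoords P) G ≠ 0}
  zero_mem' := ⟨0, 0, 1, ⟨isHomogeneous_zero _ _ _, isHomogeneous_one _ _, by simp⟩, by simp⟩
  one_mem' := ⟨0, 1, 1, ⟨isHomogeneous_one _ _, isHomogeneous_one _ _, by simp⟩, by simp⟩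
  add_mem' := by
    rintro f g ⟨n, F, G, ⟨hF, hG, e⟩, h⟩ ⟨m, F', G', ⟨hF', hG', e'⟩, h'⟩
    refine ⟨n + m, F * G' + G * F', G * G', ⟨(hF.mul hG').add (hG.mul hF'), hG.mul hG', ?_⟩, ?_⟩
    · simp only [map_mul, map_add, ← e, ← e']; ring
    · simpa using ⟨h, h'⟩
  mul_mem' := by
    rintro f g ⟨n, F, G, ⟨hF, hG, e⟩, h⟩ ⟨m, F', G', ⟨hF', hG', e'⟩, h'⟩
    refine ⟨n + m, F * F', G * G', ⟨hF.mul hF', hG.mul hG', ?_⟩, ?_⟩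
    · simp only [map_mul, ← e, ← e']; ring
    · simpa using ⟨h, h'⟩
  neg_mem' := by
    rintro f ⟨n, F, G, ⟨hF, hG, e⟩, h⟩
    exact ⟨n, -F, G, ⟨hF.neg, hG, by simp [← e]⟩, h⟩

/-- The maximal ideal of the local ring at `P`: the regular functions that vanish at `P`. -/
def vanishingIdeal (P : E.Point) : Ideal (localRing P) where
  carrier := {f | ∃ (n : ℕ) (F G : MvPolynomial (Fin 3) k),
    IsQuotient (f : E.FunctionField) n F G ∧ eval (homCoords P) G ≠ 0 ∧ eval (homCoords P) F = 0}
  zero_mem' :=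
    ⟨0, 0, 1, ⟨isHomogeneous_zero _ _ _, isHomogeneous_one _ _, by simp⟩, by simp, by simp⟩
  add_mem' := by
    rintro f g ⟨n, F, G, ⟨hF, hG, e⟩, h, h0⟩ ⟨m, F', G', ⟨hF', hG', e'⟩, h', h0'⟩
    refine ⟨n + m, F * G' + G * F', G * G', ⟨(hF.mul hG').add (hG.mul hF'), hG.mul hG', ?_⟩,
      ?_, ?_⟩
    · simp only [map_mul, map_add, ← e, ← e', Subring.coe_add]; ring
    · simpa using ⟨h, h'⟩
    · simp [h0, h0']
  smul_mem' := by
    rintro ⟨c, n, F, G, ⟨hF, hG, e⟩, h⟩ f ⟨m, F', G', ⟨hF', hG', e'⟩, h', h0'⟩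
    refine ⟨n + m, F * F', G * G', ⟨hF.mul hF', hG.mul hG', ?_⟩, ?_, ?_⟩
    · simp only [map_mul, ← e, ← e', smul_eq_mul, Subring.coe_mul]; ring
    · simpa using ⟨h, h'⟩
    · simp [h0']

/-- The multiplicity of `P` as a zero of `f`: the largest `n` such that `f` is regular at `P` and
lies in the `n`-th power of the maximal ideal at `P`. It is `0` if `f` has a pole or a nonzero
value at `P`, and `⊤` if `f` is identically zero. -/
def zeroMultiplicity (f : E.FunctionField) (P : E.Point) : ℕ∞ :=
  ⨆ (n : ℕ) (_ : ∃ h : f ∈ localRing P, (⟨f, h⟩ : localRing P) ∈ vanishingIdeal P ^ n), (n : ℕ∞)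

/-- The degree of a nonzero rational function on `E`: the number of its zeros, counted with
multiplicities. (For the zero function this gives `⊤`.) -/
def degree (f : E.FunctionField) : ℕ∞ :=
  ∑' P : E.Point, zeroMultiplicity f P

end

end EllipticFunction

namespace EllipticFunction

open MvPolynomial
open scoped Matrix

noncomputable section

/-! ### Behaviour at the point at infinity, read off from degrees of norms to `k[X]` -/

section Infinity

/-! Regard `E` as a smooth plane cubic. Projecting from a point `R` of `E` sends a point `P` to the
line `RP`. This is a function of degree 2, because a line through `R` meets the cubic in two further
points. Following the projection by a Möbius map gives again a quotient of two linear forms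
vanishing at `R`, still of degree 2 (`degree_eq_two_of_frame`). A Möbius map is determined by three
values, so the four prescribed values can be attained by projecting from `R` exactly when the four
lines from `R` to `α`, `β`, `γ`, `δ` have the same cross ratio `l` as `a`, `b`, `c`, `d`
(`interpolates_of_cross_ratio`, for the direction needed).

It remains to find `R`. The cross ratio of the four lines is the rational function `h(R) =
(αγR)(βδR) / ((αδR)(βγR))`, with brackets denoting determinants. It is not constant: a conic cannot
contain the cubic, so a linear relation between numerator and denominator would hold on the whole
plane, which is impossible since no four points of `E` are collinear (`cross_products_independent`).
Hence `1 / (h - l)` is not constant either. A function regular at every point of `E` is constant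
(`exists_eq_algebraMap_of_forall_mem_localRing`), so `1 / (h - l)` has a pole, and this pole is the
required `R`.

The values `0`, `1`, `∞` of the cross ratio are avoided since `a`, `b`, `c`, `d` are distinct. This
excludes the degenerate positions of `R`, such as `R` on the line `γδ`. If `R` is one of the four
points, the tangent at `R` replaces the missing line. The symmetry of the cross ratio reduces this
case to `R = α` (`interpolates_or_crossQuot_mem_left`).

The degree is computed by hand. In coordinates adapted to `R` the cubic reads `x A + y ω₁ ω₂`, so `x
/ y = -ω₁ ω₂ / A` on `E`, and the zeros are the two residual points where `x = ω₁ = 0` or `x = ω₂ =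
0`. Smoothness of the cubic settles the multiplicities (`zeroMultiplicity_of_relation`). -/

theorem norm_coordinateRing_zero {k : Type*} [Field k] (E : WeierstrassCurve.Affine k) :
    Algebra.norm (Polynomial k) (0 : E.CoordinateRing) = 0 := by
  simpa using WeierstrassCurve.Affine.CoordinateRing.norm_smul_basis (W' := E) 0 0

-- The degree of the norm plays the role of the pole order at infinity. For `p + q y` it is `max (2
-- deg p) (2 deg q + 3)`, where parity rules out cancellation, so it satisfies the ultrametric
-- inequality.
open Polynomial in
theorem degree_norm_add_le {k : Type*} [Field k] (E : WeierstrassCurve.Affine k)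
    (f g : E.CoordinateRing) :
    (Algebra.norm k[X] (f + g)).degree ≤
      max (Algebra.norm k[X] f).degree (Algebra.norm k[X] g).degree := by
  obtain ⟨p, q, rfl⟩ := WeierstrassCurve.Affine.CoordinateRing.exists_smul_basis_eq f
  obtain ⟨p', q', rfl⟩ := WeierstrassCurve.Affine.CoordinateRing.exists_smul_basis_eq g
  have e : p • (1 : E.CoordinateRing) + q • WeierstrassCurve.Affine.CoordinateRing.mk E X +
      (p' • (1 : E.CoordinateRing) + q' • WeierstrassCurve.Affine.CoordinateRing.mk E X) =
      (p + p') • (1 : E.CoordinateRing) +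
        (q + q') • WeierstrassCurve.Affine.CoordinateRing.mk E X := by
    simp only [add_smul]; abel
  rw [e]
  simp only [WeierstrassCurve.Affine.CoordinateRing.degree_norm_smul_basis]
  have h1 := degree_add_le p p'
  have h2 := degree_add_le q q'
  refine max_le ?_ ?_
  · rcases le_max_iff.mp h1 with h | h
    · exact (nsmul_le_nsmul_right h 2).trans ((le_max_left _ _).trans (le_max_left _ _))
    · exact (nsmul_le_nsmul_right h 2).trans ((le_max_left _ _).trans (le_max_right _ _))
  · rcases le_max_iff.mp h2 with h | h
    · exact (add_le_add_left (nsmul_le_nsmul_right h 2) 3).trans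
        ((le_max_right _ _).trans (le_max_left _ _))
    · exact (add_le_add_left (nsmul_le_nsmul_right h 2) 3).trans
        ((le_max_right _ _).trans (le_max_right _ _))

variable {k : Type*} [Field k] (E : WeierstrassCurve.Affine k)

/-- The triple `(x, y, 1)` in the affine coordinate ring of `E`. -/
def affineCoords : Fin 3 → E.CoordinateRing :=
  ![WeierstrassCurve.Affine.CoordinateRing.mk E (Polynomial.C Polynomial.X),
    WeierstrassCurve.Affine.CoordinateRing.mk E Polynomial.X, 1]

theorem aeval_affineCoords_polynomial :
    aeval (affineCoords E) (WeierstrassCurve.Projective.polynomial E) = 0 := by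
  have h : WeierstrassCurve.Affine.CoordinateRing.mk E E.polynomial = 0 := AdjoinRoot.mk_self
  have hC : ∀ r : k, algebraMap k E.CoordinateRing r =
    AdjoinRoot.of E.polynomial (Polynomial.C r) := fun r => rfl
  rw [← h, WeierstrassCurve.Projective.polynomial]
  simp only [WeierstrassCurve.Affine.polynomial]
  simp [affineCoords, hC]
  ring

theorem aeval_genericCoords (H : MvPolynomial (Fin 3) k) :
    aeval (genericCoords E) H =
      algebraMap E.CoordinateRing E.FunctionField (aeval (affineCoords E) H) := by
  have : genericCoords E = fun i => algebraMap E.CoordinateRing E.FunctionField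
      (affineCoords E i) := by
    funext i
    fin_cases i <;> simp [genericCoords, affineCoords]
  rw [this]
  exact MvPolynomial.aeval_algebraMap_apply _ _ _

open Polynomial in
theorem degree_norm_x : (Algebra.norm k[X] (affineCoords E 0)).degree = 2 := by
  have : affineCoords E 0 = (X : k[X]) • (1 : E.CoordinateRing) +
      (0 : k[X]) • WeierstrassCurve.Affine.CoordinateRing.mk E X := by
    simp [affineCoords, WeierstrassCurve.Affine.CoordinateRing.smul]
  rw [this, WeierstrassCurve.Affine.CoordinateRing.degree_norm_smul_basis]
  simp

open Polynomial in
theorem degree_norm_y : (Algebra.norm k[X] (affineCoords E 1)).degree = 3 := by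
  have : affineCoords E 1 = (0 : k[X]) • (1 : E.CoordinateRing) +
      (1 : k[X]) • WeierstrassCurve.Affine.CoordinateRing.mk E X := by
    simp [affineCoords]
  rw [this, WeierstrassCurve.Affine.CoordinateRing.degree_norm_smul_basis]
  simp

open Polynomial in
theorem degree_norm_algebraMap {c : k} (hc : c ≠ 0) :
    (Algebra.norm k[X] (algebraMap k E.CoordinateRing c)).degree = 0 := by
  have : algebraMap k E.CoordinateRing c = (C c : k[X]) • (1 : E.CoordinateRing) +
      (0 : k[X]) • WeierstrassCurve.Affine.CoordinateRing.mk E X := by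
    rw [zero_smul, add_zero, ← Algebra.algebraMap_eq_smul_one,
      IsScalarTower.algebraMap_apply k k[X] E.CoordinateRing]
    rfl
  rw [this, WeierstrassCurve.Affine.CoordinateRing.degree_norm_smul_basis]
  simp [Polynomial.degree_C hc]

open Polynomial in
theorem degree_norm_monomial (m : Fin 3 →₀ ℕ) {c : k} (hc : c ≠ 0) :
    (Algebra.norm k[X] (aeval (affineCoords E) (MvPolynomial.monomial m c))).degree =
      ((2 * m 0 + 3 * m 1 : ℕ) : WithBot ℕ) := by
  rw [MvPolynomial.aeval_monomial, Finsupp.prod_fintype _ _ (fun i => pow_zero _),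
    Fin.prod_univ_three]
  have h2 : affineCoords E 2 = 1 := rfl
  simp only [map_mul, map_pow, degree_mul, degree_pow, degree_norm_algebraMap E hc,
    degree_norm_x, degree_norm_y, h2, map_one, Polynomial.degree_one, smul_zero, add_zero,
    zero_add]
  push_cast
  simp [mul_comm]

open Polynomial in
theorem degree_norm_aeval_le {H : MvPolynomial (Fin 3) k} {N : ℕ}
    (h : ∀ m ∈ H.support, 2 * m 0 + 3 * m 1 ≤ N) :
    (Algebra.norm k[X] (aeval (affineCoords E) H)).degree ≤ N := by
  have key : ∀ s : Finset (Fin 3 →₀ ℕ), s ⊆ H.support → (Algebra.norm k[X]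
      (∑ m ∈ s, aeval (affineCoords E) (MvPolynomial.monomial m (H.coeff m)))).degree ≤ N := by
    classical
    intro s
    induction s using Finset.induction_on with
    | empty =>
      intro _
      rw [Finset.sum_empty, norm_coordinateRing_zero]
      simp
    | insert a s ha ih =>
      intro hs
      rw [Finset.sum_insert ha]
      refine (degree_norm_add_le E _ _).trans (max_le ?_ (ih fun x hx => hs (by simp [hx])))
      have haH := hs (Finset.mem_insert_self a s)
      rw [degree_norm_monomial E a (MvPolynomial.mem_support_iff.mp haH)]
      exact_mod_cast h a haH
  conv_lhs => rw [H.as_sum, map_sum]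
  exact key _ subset_rfl

theorem IsHomogeneous.sum_eq {H : MvPolynomial (Fin 3) k} {n : ℕ} (hH : H.IsHomogeneous n)
    {m : Fin 3 →₀ ℕ} (hm : m ∈ H.support) : m 0 + m 1 + m 2 = n := by
  have := hH (mem_support_iff.mp hm)
  rw [Finsupp.weight_apply, Finsupp.sum_fintype _ _ (by simp)] at this
  simpa [Fin.sum_univ_three] using this

open Polynomial in
theorem degree_norm_aeval_homogeneous_le {H : MvPolynomial (Fin 3) k} {n : ℕ}
    (hH : H.IsHomogeneous n) :
    (Algebra.norm k[X] (aeval (affineCoords E) H)).degree ≤ (3 * n : ℕ) :=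
  degree_norm_aeval_le E fun m hm => by
    have := IsHomogeneous.sum_eq hH hm
    omega

theorem coeff_eq_eval {H : MvPolynomial (Fin 3) k} {n : ℕ} (hH : H.IsHomogeneous n) :
    H.coeff (Finsupp.single 1 n) = eval ![0, 1, 0] H := by
  classical
  rw [eval_eq']
  rw [Finset.sum_eq_single (Finsupp.single 1 n)]
  · simp [Fin.prod_univ_three]
  · intro m hm hne
    have hs := IsHomogeneous.sum_eq hH hm
    have : m 0 ≠ 0 ∨ m 2 ≠ 0 := by
      by_contra hcon
      push Not at hcon
      apply hne
      ext i
      fin_cases i <;> simp <;> omega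
    rcases this with h | h <;> simp [Fin.prod_univ_three, h]
  · intro h
    rw [notMem_support_iff.mp h, zero_mul]

-- Among monomials of degree `n` only `y ^ n` reaches pole order `3 n` at infinity, and its
-- coefficient is the value of the form at `[0 : 1 : 0]`.
open Polynomial in
theorem degree_norm_aeval_of_eval_ne_zero {H : MvPolynomial (Fin 3) k} {n : ℕ}
    (hH : H.IsHomogeneous n) (h0 : eval ![0, 1, 0] H ≠ 0) :
    (Algebra.norm k[X] (aeval (affineCoords E) H)).degree = (3 * n : ℕ) := by
  classical
  set c := eval ![0, 1, 0] H with hc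
  set M := MvPolynomial.monomial (Finsupp.single (1 : Fin 3) n) c with hM
  have hMdeg : (Algebra.norm k[X] (aeval (affineCoords E) M)).degree = (3 * n : ℕ) := by
    rw [hM, degree_norm_monomial E _ h0]
    simp
  refine le_antisymm (degree_norm_aeval_homogeneous_le E hH) ?_
  -- Once `y ^ n` is cancelled, every remaining monomial has `m 0 + m 2 > 0`, and `2 m₀ + 3 m₁ = 3 n
  -- - m₀ - 3 m₂`.
  have hsub : ∀ m ∈ (M - H).support, 2 * m 0 + 3 * m 1 + 1 ≤ 3 * n := by
    intro m hm
    have hsum : m 0 + m 1 + m 2 = n :=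
      IsHomogeneous.sum_eq (((isHomogeneous_monomial _ (by simp)) : M.IsHomogeneous n).sub hH) hm
    have : m ≠ Finsupp.single 1 n := by
      rintro rfl
      rw [MvPolynomial.mem_support_iff, MvPolynomial.coeff_sub, coeff_eq_eval hH, hM,
        MvPolynomial.coeff_monomial, if_pos rfl] at hm
      exact hm (sub_self _)
    by_contra hcon
    apply this
    ext i
    fin_cases i <;> simp <;> omega
  by_contra hlt
  push Not at hlt
  have h1 : (Algebra.norm k[X] (aeval (affineCoords E) (M - H))).degree < (3 * n : ℕ) := by
    rcases Nat.eq_zero_or_pos n with rfl | hn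
    · have : M - H = 0 := by
        rw [← MvPolynomial.support_eq_empty, Finset.eq_empty_iff_forall_notMem]
        intro m hm
        have := hsub m hm
        omega
      rw [this, map_zero, norm_coordinateRing_zero, Polynomial.degree_zero]
      exact WithBot.bot_lt_coe _
    · refine (degree_norm_aeval_le E (N := 3 * n - 1) fun m hm => ?_).trans_lt ?_
      · have := hsub m hm
        omega
      · exact_mod_cast (by omega : 3 * n - 1 < 3 * n)
  have h2 := degree_norm_add_le E (aeval (affineCoords E) (M - H)) (aeval (affineCoords E) H)
  rw [← map_add, sub_add_cancel, hMdeg] at h2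
  exact absurd h2 (not_le.mpr (max_lt h1 hlt))

end Infinity

/-! ### Forms vanishing at the generic point vanish at every point -/

section Vanishing

variable {k : Type*} [Field k] {E : WeierstrassCurve.Affine k}

/-- Evaluation of elements of the coordinate ring at an affine point. -/
def evalAffine {x y : k} (h : E.Nonsingular x y) : E.CoordinateRing →+* k :=
  AdjoinRoot.lift (Polynomial.evalRingHom x) y (by
    have := h.1
    rw [WeierstrassCurve.Affine.Equation, Polynomial.evalEval] at this
    rw [← this, Polynomial.eval₂_evalRingHom])

theorem evalAffine_aeval {x y : k} (h : E.Nonsingular x y) (H : MvPolynomial (Fin 3) k) :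
    evalAffine h (aeval (affineCoords E) H) = eval ![x, y, 1] H := by
  have : (evalAffine h).comp (aeval (affineCoords E)).toRingHom = eval ![x, y, 1] := by
    refine MvPolynomial.ringHom_ext (fun r => ?_) (fun i => ?_)
    · simp only [AlgHom.toRingHom_eq_coe, RingHom.coe_comp, RingHom.coe_coe, Function.comp_apply,
        algHom_C, eval_C]
      rw [IsScalarTower.algebraMap_apply k (Polynomial k) E.CoordinateRing]
      exact (AdjoinRoot.lift_of _).trans (by simp)
    · fin_cases i <;> simp [affineCoords, evalAffine]
  exact congrArg (fun φ : MvPolynomial (Fin 3) k →+* k => φ H) this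

/-- This makes values of quotients `F / G` independent of the chosen representation. Affine points
are handled by specialisation, the point at infinity by the norm degree. -/
theorem eval_homCoords_eq_zero {H : MvPolynomial (Fin 3) k} {n : ℕ} (hH : H.IsHomogeneous n)
    (h : aeval (genericCoords E) H = 0) (P : E.Point) : eval (homCoords P) H = 0 := by
  rw [aeval_genericCoords, map_eq_zero_iff _ (IsFractionRing.injective _ _)] at h
  cases P with
  | zero =>
    by_contra h0
    have := degree_norm_aeval_of_eval_ne_zero E hH h0
    rw [h, norm_coordinateRing_zero, Polynomial.degree_zero] at this
    exact WithBot.bot_ne_coe this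
  | some x y hP =>
    rw [homCoords, ← evalAffine_aeval hP, h, map_zero]

end Vanishing

/-! ### Functions regular everywhere are constant -/

section Global

variable {k : Type*} [Field k] {E : WeierstrassCurve.Affine k}

/-- Nullstellensatz: the residue field is finite over the algebraically closed `k`, hence equal to
`k`, and the residues of `x` and `y` are the coordinates of the point. -/
theorem exists_point_of_isMaximal [IsAlgClosed k] [E.IsElliptic] (M : Ideal E.CoordinateRing)
    [hM : M.IsMaximal] : ∃ (x y : k) (_ : E.Nonsingular x y), ∀ H : MvPolynomial (Fin 3) k,
      aeval (affineCoords E) H ∈ M → eval ![x, y, 1] H = 0 := by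
  let _ := Ideal.Quotient.field M
  have : Module.Finite (Polynomial k) E.CoordinateRing :=
    Module.Finite.of_basis (WeierstrassCurve.Affine.CoordinateRing.basis E)
  have : Algebra.FiniteType k E.CoordinateRing :=
    Algebra.FiniteType.trans (S := Polynomial k) inferInstance inferInstance
  have : Algebra.FiniteType k (E.CoordinateRing ⧸ M) :=
    Algebra.FiniteType.of_surjective (Ideal.Quotient.mkₐ k M) Ideal.Quotient.mk_surjective
  have : Module.Finite k (E.CoordinateRing ⧸ M) := finite_of_finite_type_of_isJacobsonRing _ _
  have hbij : Function.Bijective (algebraMap k (E.CoordinateRing ⧸ M)) :=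
    IsAlgClosed.algebraMap_bijective_of_isIntegral
  obtain ⟨x, hx⟩ := hbij.2 (Ideal.Quotient.mk M (affineCoords E 0))
  obtain ⟨y, hy⟩ := hbij.2 (Ideal.Quotient.mk M (affineCoords E 1))
  have key : ∀ H : MvPolynomial (Fin 3) k, algebraMap k (E.CoordinateRing ⧸ M)
      (eval ![x, y, 1] H) = Ideal.Quotient.mk M (aeval (affineCoords E) H) := by
    intro H
    have : (algebraMap k (E.CoordinateRing ⧸ M)).comp (eval ![x, y, 1]) =
        (Ideal.Quotient.mk M).comp (aeval (affineCoords E)).toRingHom := by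
      refine MvPolynomial.ringHom_ext (fun r => ?_) (fun i => ?_)
      · simp
      · fin_cases i
        · simpa using hx
        · simpa using hy
        · simp [affineCoords]
    exact congrArg (fun φ : MvPolynomial (Fin 3) k →+* _ => φ H) this
  refine ⟨x, y, ?_, fun H hH => ?_⟩
  · rw [← WeierstrassCurve.Affine.equation_iff_nonsingular]
    rw [← WeierstrassCurve.Projective.equation_some (W' := E), WeierstrassCurve.Projective.Equation]
    apply hbij.1
    rw [map_zero, key]
    rw [aeval_affineCoords_polynomial, map_zero]
  · apply hbij.1
    rw [key, map_zero, Ideal.Quotient.eq_zero_iff_mem]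
    exact hH

/-- Regularity at the affine points puts `f` in the coordinate ring. Regularity at infinity then
bounds its norm degree by `0`, which leaves only constants because `y` contributes at least `3`. -/
theorem exists_eq_algebraMap_of_forall_mem_localRing [IsAlgClosed k] [E.IsElliptic]
    {f : E.FunctionField} (h : ∀ P : E.Point, f ∈ localRing P) :
    ∃ c : k, f = algebraMap k E.FunctionField c := by
  have hinj : Function.Injective (algebraMap E.CoordinateRing E.FunctionField) :=
    IsFractionRing.injective _ _
  obtain ⟨b, rfl⟩ : ∃ b, algebraMap E.CoordinateRing E.FunctionField b = f := by
    -- The ideal of denominators of `f`. If it were proper it would lie in the maximal ideal of some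
    -- point, but regularity there supplies a denominator that does not vanish at that point.
    let I : Ideal E.CoordinateRing :=
      { carrier := {b | ∃ a, f * algebraMap E.CoordinateRing E.FunctionField b =
          algebraMap E.CoordinateRing E.FunctionField a}
        zero_mem' := ⟨0, by simp⟩
        add_mem' := by
          rintro b b' ⟨a, ha⟩ ⟨a', ha'⟩
          exact ⟨a + a', by rw [map_add, mul_add, ha, ha', map_add]⟩
        smul_mem' := by
          rintro c b ⟨a, ha⟩
          exact ⟨c * a, by rw [smul_eq_mul, map_mul, mul_left_comm, ha, map_mul]⟩ }
    by_cases hI : I = ⊤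
    · obtain ⟨a, ha⟩ : (1 : E.CoordinateRing) ∈ I := hI ▸ Submodule.mem_top
      exact ⟨a, by rw [← ha, map_one, mul_one]⟩
    · obtain ⟨M, hM, hIM⟩ := Ideal.exists_le_maximal I hI
      obtain ⟨x, y, hxy, hker⟩ := exists_point_of_isMaximal M
      obtain ⟨n, F, G, ⟨-, -, e⟩, hG⟩ := h (.some x y hxy)
      rw [aeval_genericCoords, aeval_genericCoords] at e
      exact absurd (hker G (hIM ⟨_, e⟩)) hG
  obtain ⟨n, F, G, ⟨hF, hG, e⟩, h0⟩ := h .zero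
  rw [aeval_genericCoords, aeval_genericCoords, ← map_mul] at e
  have e' := congrArg (fun r => (Algebra.norm (Polynomial k) r).degree) (hinj e)
  simp only [map_mul, Polynomial.degree_mul] at e'
  rw [degree_norm_aeval_of_eval_ne_zero E hG h0] at e'
  have hle := degree_norm_aeval_homogeneous_le E hF
  rw [← e'] at hle
  obtain ⟨p, q, rfl⟩ := WeierstrassCurve.Affine.CoordinateRing.exists_smul_basis_eq b
  rw [WeierstrassCurve.Affine.CoordinateRing.degree_norm_smul_basis] at hle
  have hle0 : max (2 • p.degree) (2 • q.degree + 3) ≤ 0 := by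
    by_contra hcon
    push Not at hcon
    refine absurd hle (not_le.mpr ?_)
    calc ((3 * n : ℕ) : WithBot ℕ) = 0 + (3 * n : ℕ) := (zero_add _).symm
      _ < _ := WithBot.add_lt_add_right (WithBot.coe_ne_bot) hcon
  have hq : q = 0 := by
    by_contra hq
    have := (le_max_right _ _).trans hle0
    rw [Polynomial.degree_eq_natDegree hq] at this
    have h3 : 2 * q.natDegree + 3 ≤ 0 := by
      have h4 : ((2 * q.natDegree + 3 : ℕ) : WithBot ℕ) ≤ ((0 : ℕ) : WithBot ℕ) := by
        push_cast
        simpa [two_nsmul, two_mul] using this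
      exact_mod_cast h4
    omega
  have hp : p.degree ≤ 0 := by
    by_cases hp : p = 0
    · simp [hp]
    have := (le_max_left _ _).trans hle0
    rw [Polynomial.degree_eq_natDegree hp] at this ⊢
    have h4 : ((2 * p.natDegree : ℕ) : WithBot ℕ) ≤ ((0 : ℕ) : WithBot ℕ) := by
      push_cast
      simpa [two_nsmul, two_mul] using this
    have h5 : 2 * p.natDegree ≤ 0 := by exact_mod_cast h4
    exact_mod_cast (by omega : p.natDegree ≤ 0)
  refine ⟨p.coeff 0, ?_⟩
  rw [hq, zero_smul, add_zero, Polynomial.eq_C_of_degree_le_zero hp, Polynomial.coeff_C_zero,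
    IsScalarTower.algebraMap_apply k E.CoordinateRing E.FunctionField,
    IsScalarTower.algebraMap_apply k (Polynomial k) E.CoordinateRing,
    Algebra.algebraMap_eq_smul_one]
  simp [← Algebra.algebraMap_eq_smul_one]

end Global

/-! ### Linear forms and conics on the cubic -/

section Forms

variable {k : Type*} [Field k]

/-- The linear form in three variables with given coefficients. -/
def linForm (ξ : Fin 3 → k) : MvPolynomial (Fin 3) k := ∑ i, C (ξ i) * X i

theorem linForm_isHomogeneous (ξ : Fin 3 → k) : (linForm ξ).IsHomogeneous 1 :=
  IsHomogeneous.sum _ _ _ fun i _ => by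
    simpa using (isHomogeneous_C (Fin 3) (ξ i)).mul (isHomogeneous_X k i)

theorem eval_linForm (v ξ : Fin 3 → k) : eval v (linForm ξ) = ξ ⬝ᵥ v := by
  simp [linForm, dotProduct]

theorem linForm_smul (c : k) (ξ : Fin 3 → k) : linForm (c • ξ) = C c * linForm ξ := by
  simp [linForm, Finset.mul_sum, mul_assoc]

theorem linForm_neg (ξ : Fin 3 → k) : linForm (-ξ) = -linForm ξ := by
  simp [linForm]

theorem linForm_add (ξ ω : Fin 3 → k) : linForm (ξ + ω) = linForm ξ + linForm ω := by
  simp [linForm, add_mul, Finset.sum_add_distrib]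

theorem pderiv_linForm (i : Fin 3) (ξ : Fin 3 → k) : pderiv i (linForm ξ) = C (ξ i) := by
  classical
  simp [linForm, Pi.single_apply]

theorem aeval_mul_of_isHomogeneous {K : Type*} [Field K] [Algebra k K]
    {H : MvPolynomial (Fin 3) k} {n : ℕ} (hH : H.IsHomogeneous n) (c : K) (s : Fin 3 → K) :
    aeval (fun i => c * s i) H = c ^ n * aeval s H := by
  rw [aeval_def, aeval_def, eval₂_eq', eval₂_eq', Finset.mul_sum]
  refine Finset.sum_congr rfl fun m hm => ?_
  rw [Fin.prod_univ_three, Fin.prod_univ_three, ← IsHomogeneous.sum_eq hH hm]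
  simp only [mul_pow, pow_add]
  ring

theorem eval_smul_of_isHomogeneous {H : MvPolynomial (Fin 3) k} {n : ℕ} (hH : H.IsHomogeneous n)
    (c : k) (v : Fin 3 → k) : eval (c • v) H = c ^ n * eval v H :=
  aeval_mul_of_isHomogeneous hH c v

variable (E : WeierstrassCurve.Affine k)

/-- The value of a linear form at the generic point of `E`. -/
def lin (ξ : Fin 3 → k) : E.FunctionField := aeval (genericCoords E) (linForm ξ)

theorem lin_eq (ξ : Fin 3 → k) : lin E ξ = algebraMap k _ (ξ 0) * genericCoords E 0 +
    algebraMap k _ (ξ 1) * genericCoords E 1 + algebraMap k _ (ξ 2) * genericCoords E 2 := by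
  simp [lin, linForm, Fin.sum_univ_three]

theorem lin_smul (c : k) (ξ : Fin 3 → k) : lin E (c • ξ) = algebraMap k _ c * lin E ξ := by
  simp [lin, linForm_smul]

theorem lin_neg (ξ : Fin 3 → k) : lin E (-ξ) = -lin E ξ := by
  simp [lin, linForm_neg]

theorem lin_add (ξ ω : Fin 3 → k) : lin E (ξ + ω) = lin E ξ + lin E ω := by
  simp [lin, linForm_add]

/-- A conic does not contain the cubic: after replacing `y ^ 2` by the Weierstrass equation,
coefficients are compared in the basis `1, y` over `k[X]`. The coefficient of `X ^ 3` kills `C`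
first, and the others follow. -/
theorem quadratic_coeffs_eq_zero {A B C D F G : k}
    (h : algebraMap k E.FunctionField A * genericCoords E 0 ^ 2 +
      algebraMap k _ B * (genericCoords E 0 * genericCoords E 1) +
      algebraMap k _ C * genericCoords E 1 ^ 2 + algebraMap k _ D * genericCoords E 0 +
      algebraMap k _ F * genericCoords E 1 + algebraMap k _ G = 0) :
    A = 0 ∧ B = 0 ∧ C = 0 ∧ D = 0 ∧ F = 0 ∧ G = 0 := by
  have hsc : ∀ c : k, algebraMap k E.FunctionField c = algebraMap E.CoordinateRing _
      (WeierstrassCurve.Affine.CoordinateRing.mk E (Polynomial.C (Polynomial.C c))) := fun c => by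
    rw [IsScalarTower.algebraMap_apply k E.CoordinateRing E.FunctionField]
    rfl
  have hg0 : genericCoords E 0 = algebraMap E.CoordinateRing _
      (WeierstrassCurve.Affine.CoordinateRing.mk E (Polynomial.C Polynomial.X)) := rfl
  have hg1 : genericCoords E 1 = algebraMap E.CoordinateRing _
      (WeierstrassCurve.Affine.CoordinateRing.mk E Polynomial.X) := rfl
  simp only [hsc, hg0, hg1, ← map_mul, ← map_pow, ← map_add] at h
  rw [map_eq_zero_iff (algebraMap E.CoordinateRing E.FunctionField)
    (IsFractionRing.injective _ _)] at h
  have hY := WeierstrassCurve.Affine.CoordinateRing.smul_basis_mul_Y (W' := E) 0 1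
  simp only [zero_smul, one_smul, zero_add, one_mul, zero_sub] at hY
  have key : ((Polynomial.C A * Polynomial.X ^ 2 + Polynomial.C D * Polynomial.X + Polynomial.C G
      + Polynomial.C C * (Polynomial.X ^ 3 + Polynomial.C E.a₂ * Polynomial.X ^ 2 +
        Polynomial.C E.a₄ * Polynomial.X + Polynomial.C E.a₆) : Polynomial k)) •
        (1 : E.CoordinateRing) +
      ((Polynomial.C B * Polynomial.X + Polynomial.C F - Polynomial.C C *
        (Polynomial.C E.a₁ * Polynomial.X + Polynomial.C E.a₃) : Polynomial k)) •
        WeierstrassCurve.Affine.CoordinateRing.mk E Polynomial.X = 0 := by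
    rw [← h]
    simp only [WeierstrassCurve.Affine.CoordinateRing.smul, map_add, map_mul, map_pow, map_sub,
      map_neg] at hY ⊢
    linear_combination (-WeierstrassCurve.Affine.CoordinateRing.mk E
      (Polynomial.C (Polynomial.C C))) * hY
  obtain ⟨h1, h2⟩ := WeierstrassCurve.Affine.CoordinateRing.smul_basis_eq_zero key
  have c3 := congrArg (Polynomial.coeff · 3) h1
  simp [Polynomial.coeff_X_pow] at c3
  subst c3
  have c2 := congrArg (Polynomial.coeff · 2) h1
  have c1 := congrArg (Polynomial.coeff · 1) h1
  have c0 := congrArg (Polynomial.coeff · 0) h1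
  have d1 := congrArg (Polynomial.coeff · 1) h2
  have d0 := congrArg (Polynomial.coeff · 0) h2
  simp [Polynomial.coeff_X, Polynomial.coeff_C] at c2 c1 c0 d1 d0
  exact ⟨c2, d1, rfl, c1, d0, c0⟩

/-- An identity between products of two lines on `E` extends to the whole plane, so it may be tested
at vectors that are not on `E`. -/
theorem lin_mul_lin_eq {u v u' v' : Fin 3 → k} {c c' : k}
    (h : algebraMap k _ c * (lin E u * lin E v) = algebraMap k _ c' * (lin E u' * lin E v'))
    (w : Fin 3 → k) : c * ((u ⬝ᵥ w) * (v ⬝ᵥ w)) = c' * ((u' ⬝ᵥ w) * (v' ⬝ᵥ w)) := by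
  have h2 : genericCoords E 2 = 1 := rfl
  obtain ⟨h1, h2, h3, h4, h5, h6⟩ := quadratic_coeffs_eq_zero E
    (A := c * (u 0 * v 0) - c' * (u' 0 * v' 0))
    (B := c * (u 0 * v 1 + u 1 * v 0) - c' * (u' 0 * v' 1 + u' 1 * v' 0))
    (C := c * (u 1 * v 1) - c' * (u' 1 * v' 1))
    (D := c * (u 0 * v 2 + u 2 * v 0) - c' * (u' 0 * v' 2 + u' 2 * v' 0))
    (F := c * (u 1 * v 2 + u 2 * v 1) - c' * (u' 1 * v' 2 + u' 2 * v' 1))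
    (G := c * (u 2 * v 2) - c' * (u' 2 * v' 2)) (by
      simp only [lin_eq, h2] at h
      simp only [map_sub, map_mul, map_add]
      linear_combination h)
  simp only [dotProduct, Fin.sum_univ_three]
  linear_combination w 0 ^ 2 * h1 + w 0 * w 1 * h2 + w 1 ^ 2 * h3 + w 0 * w 2 * h4 +
    w 1 * w 2 * h5 + w 2 ^ 2 * h6

variable {E}

theorem lin_ne_zero {ξ : Fin 3 → k} (hξ : ξ ≠ 0) : lin E ξ ≠ 0 := by
  intro h
  have key := lin_mul_lin_eq E (u := ξ) (v := ξ) (u' := ξ) (v' := ξ) (c := 1) (c' := 0)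
    (by simp [h])
  apply hξ
  funext i
  have := key (Pi.single i 1)
  simpa using this

end Forms

/-! ### Local rings, uniformizers and multiplicities -/

section LocalRing

variable {k : Type*} [Field k] {E : WeierstrassCurve.Affine k}

theorem IsQuotient.eval_mul_eval_eq {f : E.FunctionField} {n m : ℕ}
    {F G F' G' : MvPolynomial (Fin 3) k} (h : IsQuotient f n F G) (h' : IsQuotient f m F' G')
    (P : E.Point) : eval (homCoords P) F * eval (homCoords P) G' =
      eval (homCoords P) F' * eval (homCoords P) G := by
  have hhom : (F * G' - F' * G).IsHomogeneous (n + m) :=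
    (h.1.mul h'.2.1).sub (by simpa [add_comm] using h'.1.mul h.2.1)
  have := eval_homCoords_eq_zero hhom (by
    rw [map_sub, map_mul, map_mul, ← h.2.2, ← h'.2.2]; ring) P
  simpa [sub_eq_zero] using this

theorem aeval_ne_zero {H : MvPolynomial (Fin 3) k} {n : ℕ} (hH : H.IsHomogeneous n) {P : E.Point}
    (h : eval (homCoords P) H ≠ 0) : aeval (genericCoords E) H ≠ 0 :=
  fun h0 => h (eval_homCoords_eq_zero hH h0 P)

theorem isQuotient_div {F G : MvPolynomial (Fin 3) k} {n : ℕ} (hF : F.IsHomogeneous n)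
    (hG : G.IsHomogeneous n) (h0 : aeval (genericCoords E) G ≠ 0) :
    IsQuotient (aeval (genericCoords E) F / aeval (genericCoords E) G) n F G :=
  ⟨hF, hG, div_mul_cancel₀ _ h0⟩

theorem IsQuotient.eq_div {f : E.FunctionField} {n : ℕ} {F G : MvPolynomial (Fin 3) k}
    (h : IsQuotient f n F G) (h0 : aeval (genericCoords E) G ≠ 0) :
    f = aeval (genericCoords E) F / aeval (genericCoords E) G :=
  eq_div_of_mul_eq h0 h.2.2

theorem notMem_vanishingIdeal {P : E.Point} {f : localRing P} {n : ℕ}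
    {F G : MvPolynomial (Fin 3) k} (h : IsQuotient (f : E.FunctionField) n F G)
    (hF : eval (homCoords P) F ≠ 0) : f ∉ vanishingIdeal P := by
  rintro ⟨m, F', G', h', hG', hF'⟩
  have := h.eval_mul_eval_eq h' P
  rw [hF', zero_mul] at this
  exact mul_ne_zero hF hG' this

theorem zeroMultiplicity_eq_zero {P : E.Point} {f : E.FunctionField} {n : ℕ}
    {F G : MvPolynomial (Fin 3) k} (h : IsQuotient f n F G)
    (hF : eval (homCoords P) F ≠ 0) : zeroMultiplicity f P = 0 := by
  rw [zeroMultiplicity]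
  simp only [ENat.iSup_eq_zero, Nat.cast_eq_zero]
  rintro m ⟨hf, hm⟩
  by_contra h0
  exact notMem_vanishingIdeal (f := ⟨f, hf⟩) h hF (Ideal.pow_le_self h0 hm)

theorem one_le_zeroMultiplicity {P : E.Point} {f : E.FunctionField} {n : ℕ}
    {F G : MvPolynomial (Fin 3) k} (h : IsQuotient f n F G)
    (hF : eval (homCoords P) F = 0) (hG : eval (homCoords P) G ≠ 0) :
    1 ≤ zeroMultiplicity f P :=
  le_iSup₂_of_le (f := fun (n : ℕ) (_ : ∃ h : f ∈ localRing P,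
    (⟨f, h⟩ : localRing P) ∈ vanishingIdeal P ^ n) => (n : ℕ∞)) 1
    ⟨⟨n, F, G, h, hG⟩, by rw [pow_one]; exact ⟨n, F, G, h, hG, hF⟩⟩ (by simp)

/-- If `t ^ e * w` were a multiple of a higher power of `t`, cancelling `t ^ e` in the domain would
put `w` into the maximal ideal. -/
theorem zeroMultiplicity_eq_of_uniformizer {P : E.Point} {t w : localRing P} (e : ℕ)
    (ht : t ∈ vanishingIdeal P) (ht0 : t ≠ 0) (hspan : vanishingIdeal P ≤ Ideal.span {t})
    (hw : w ∉ vanishingIdeal P) {f : E.FunctionField} (hf : f = (t : E.FunctionField) ^ e * w) :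
    zeroMultiplicity f P = e := by
  have hs : vanishingIdeal P = Ideal.span {t} :=
    le_antisymm hspan ((Ideal.span_singleton_le_iff_mem _).mpr ht)
  have hmem : f ∈ localRing P := hf ▸ mul_mem (pow_mem t.2 e) w.2
  have hf' : (⟨f, hmem⟩ : localRing P) = t ^ e * w := Subtype.ext hf
  refine le_antisymm (iSup₂_le ?_) (le_iSup₂_of_le (f := fun (n : ℕ) (_ : ∃ h : f ∈ localRing P,
    (⟨f, h⟩ : localRing P) ∈ vanishingIdeal P ^ n) => (n : ℕ∞)) e ⟨hmem, ?_⟩ le_rfl)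
  · rintro n ⟨hfn, hn⟩
    by_contra hlt
    push Not at hlt
    have hlt' : e < n := by exact_mod_cast hlt
    rw [hs, Ideal.span_singleton_pow, Ideal.mem_span_singleton'] at hn
    obtain ⟨a, ha⟩ := hn
    obtain ⟨j, rfl⟩ := Nat.exists_eq_add_of_lt hlt'
    apply hw
    have : w = a * t ^ j * t := by
      apply mul_left_cancel₀ (pow_ne_zero e ht0)
      rw [← hf', ← ha]
      ring
    rw [this]
    exact Ideal.mul_mem_left _ _ ht
  · rw [hf']
    exact Ideal.mul_mem_right _ _ (Ideal.pow_mem_pow ht e)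

/-- The constants in the local ring. -/
def constHom (P : E.Point) : k →+* localRing P :=
  (algebraMap k E.FunctionField).codRestrict (localRing P) fun c =>
    ⟨0, C c, 1, ⟨isHomogeneous_C _ _, isHomogeneous_one _ _, by simp⟩, by simp⟩

theorem coe_constHom (P : E.Point) (c : k) :
    (constHom P c : E.FunctionField) = algebraMap k _ c := rfl

theorem coe_eval₂_constHom {P : E.Point} (s : Fin 3 → localRing P) (H : MvPolynomial (Fin 3) k) :
    ((eval₂ (constHom P) s H : localRing P) : E.FunctionField) =
      aeval (fun i => (s i : E.FunctionField)) H := by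
  exact hom_eval₂ H (constHom P) (localRing P).subtype s

theorem div_mem_localRing {F G : MvPolynomial (Fin 3) k} {n : ℕ} (hF : F.IsHomogeneous n)
    (hG : G.IsHomogeneous n) {P : E.Point} (h0 : eval (homCoords P) G ≠ 0) :
    aeval (genericCoords E) F / aeval (genericCoords E) G ∈ localRing P :=
  ⟨n, F, G, isQuotient_div hF hG (aeval_ne_zero hG h0), h0⟩

/-- The quotient of two linear forms, as an element of a local ring. -/
def linQuot (P : E.Point) (ξ ν : Fin 3 → k) (h : ν ⬝ᵥ homCoords P ≠ 0) : localRing P :=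
  ⟨lin E ξ / lin E ν, div_mem_localRing (linForm_isHomogeneous ξ) (linForm_isHomogeneous ν)
    (by rwa [eval_linForm])⟩

/-- Two distinct lines through `P` generate the maximal ideal at `P`. Modulo these lines the generic
point, normalised by `ν`, becomes a multiple of the coordinates of `P`, so a form vanishing at `P`
becomes zero. -/
theorem vanishingIdeal_le_span {P : E.Point} {ξ ω ν : Fin 3 → k} {c : k} (hc : c ≠ 0)
    (h : ξ ⨯₃ ω = c • homCoords P) (hν : ν ⬝ᵥ homCoords P ≠ 0) :
    vanishingIdeal P ≤ Ideal.span {linQuot P ξ ν hν, linQuot P ω ν hν} := by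
  set I := Ideal.span {linQuot P ξ ν hν, linQuot P ω ν hν}
  have hu : linQuot P ξ ν hν ∈ I := Ideal.subset_span (by simp)
  have hv : linQuot P ω ν hν ∈ I := Ideal.subset_span (by simp)
  have hν0 : lin E ν ≠ 0 :=
    aeval_ne_zero (linForm_isHomogeneous ν) (P := P) (by rwa [eval_linForm])
  rintro f ⟨n, F, G, hq, hG, hF⟩
  set D := ν ⬝ᵥ (ξ ⨯₃ ω) with hD
  have hD' : D = c * (ν ⬝ᵥ homCoords P) := by rw [hD, h, dotProduct_smul, smul_eq_mul]
  have hD0 : D ≠ 0 := hD' ▸ mul_ne_zero hc hν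
  set p₀ : Fin 3 → k := fun i => D⁻¹ * (ξ ⨯₃ ω) i with hp₀
  have hp₀' : p₀ = (ν ⬝ᵥ homCoords P)⁻¹ • homCoords P := by
    funext i
    rw [hp₀, h, hD']
    simp only [Pi.smul_apply, smul_eq_mul]
    field_simp
  -- Cramer's rule: `D X = ξ(X) (ω × ν) + ω(X) (ν × ξ) + ν(X) (ξ × ω)`, divided by `D ν(X)`, with
  -- `X` the generic point.
  let s : Fin 3 → localRing P := fun i =>
    constHom P (D⁻¹ * (ω ⨯₃ ν) i) * linQuot P ξ ν hν +
      constHom P (D⁻¹ * (ν ⨯₃ ξ) i) * linQuot P ω ν hν + constHom P (p₀ i)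
  have hs : ∀ i, genericCoords E i = lin E ν * (s i : E.FunctionField) := by
    intro i
    have hDK : algebraMap k E.FunctionField D ≠ 0 := by simpa using hD0
    have e : lin E ν * (s i : E.FunctionField) = (algebraMap k E.FunctionField D)⁻¹ *
        (algebraMap k _ ((ω ⨯₃ ν) i) * lin E ξ + algebraMap k _ ((ν ⨯₃ ξ) i) * lin E ω +
          algebraMap k _ ((ξ ⨯₃ ω) i) * lin E ν) := by
      simp only [s, p₀, coe_constHom, linQuot, Subring.coe_add, Subring.coe_mul, map_mul, map_inv₀]
      field_simp
    rw [e, eq_inv_mul_iff_mul_eq₀ hDK, hD]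
    fin_cases i <;>
    simp [lin_eq, cross_apply, dotProduct, Fin.sum_univ_three] <;> ring
  have hs' : genericCoords E = fun i => lin E ν * (s i : E.FunctionField) := funext hs
  have hval : ∀ H : MvPolynomial (Fin 3) k, H.IsHomogeneous n →
      aeval (genericCoords E) H = lin E ν ^ n * (eval₂ (constHom P) s H : localRing P) := by
    intro H hH
    rw [coe_eval₂_constHom, ← aeval_mul_of_isHomogeneous hH, ← hs']
  have hFI : eval₂ (constHom P) s F ∈ I := by
    rw [← Ideal.Quotient.eq_zero_iff_mem, hom_eval₂]
    have : (Ideal.Quotient.mk I) ∘ s = ((Ideal.Quotient.mk I).comp (constHom P)) ∘ p₀ := by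
      funext i
      simp only [Function.comp_apply, s, map_add, map_mul, Ideal.Quotient.eq_zero_iff_mem.mpr hu,
        Ideal.Quotient.eq_zero_iff_mem.mpr hv, mul_zero, zero_add, RingHom.comp_apply]
    have h2 : eval₂ ((Ideal.Quotient.mk I).comp (constHom P)) ((Ideal.Quotient.mk I) ∘ s) F =
        ((Ideal.Quotient.mk I).comp (constHom P)) (eval p₀ F) := by
      rw [this, ← eval₂_comp]
    refine Eq.trans h2 ?_
    rw [hp₀', eval_smul_of_isHomogeneous hq.1, hF, mul_zero, map_zero]
  have hG0 := aeval_ne_zero hq.2.1 hG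
  have hmem : lin E ν ^ n / aeval (genericCoords E) G ∈ localRing P := by
    rw [lin, ← map_pow]
    exact div_mem_localRing (by simpa using (linForm_isHomogeneous ν).pow n) hq.2.1 hG
  have hfe : f = ⟨_, hmem⟩ * eval₂ (constHom P) s F := by
    apply Subtype.ext
    rw [Subring.coe_mul, hq.eq_div hG0, hval F hq.1]
    ring
  rw [hfe]
  exact Ideal.mul_mem_left _ _ hFI

end LocalRing

/-! ### Points of the curve as smooth points of the plane cubic -/

section Points

variable {k : Type*} [Field k] {E : WeierstrassCurve.Affine k}

theorem aeval_genericCoords_polynomial :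
    aeval (genericCoords E) (WeierstrassCurve.Projective.polynomial E) = 0 := by
  rw [aeval_genericCoords, aeval_affineCoords_polynomial, map_zero]

theorem nonsingular_homCoords (P : E.Point) :
    WeierstrassCurve.Projective.Nonsingular E (homCoords P) := by
  cases P with
  | zero => exact WeierstrassCurve.Projective.nonsingular_zero
  | some x y h => exact (WeierstrassCurve.Projective.nonsingular_some x y).mpr h

theorem eval_polynomial_homCoords (P : E.Point) :
    eval (homCoords P) (WeierstrassCurve.Projective.polynomial E) = 0 :=
  (nonsingular_homCoords P).1

theorem exists_eval_pderiv_ne_zero (P : E.Point) :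
    ∃ i, eval (homCoords P) (pderiv i (WeierstrassCurve.Projective.polynomial E)) ≠ 0 := by
  rcases (nonsingular_homCoords P).2 with h | h | h
  exacts [⟨0, h⟩, ⟨1, h⟩, ⟨2, h⟩]

theorem homCoords_ne_zero (P : E.Point) : homCoords P ≠ 0 := by
  cases P with
  | zero => exact fun h => one_ne_zero (congrFun h 1)
  | some x y h => exact fun h => one_ne_zero (congrFun h 2)

theorem eq_of_cross_eq_zero {P Q : E.Point} (h : homCoords P ⨯₃ homCoords Q = 0) : P = Q := by
  have h0 := congrFun h 0
  have h1 := congrFun h 1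
  cases P <;> cases Q <;> simp [homCoords, cross_apply] at h0 h1 ⊢
  constructor
  · linear_combination -h1
  · linear_combination h0

theorem exists_point_of_eval_polynomial_eq_zero [E.IsElliptic] {v : Fin 3 → k} (hv : v ≠ 0)
    (h : eval v (WeierstrassCurve.Projective.polynomial E) = 0) :
    ∃ (P : E.Point) (c : k), c ≠ 0 ∧ v = c • homCoords P := by
  have h' : WeierstrassCurve.Projective.Equation E v := h
  by_cases hz : v 2 = 0
  · have hx : v 0 = 0 := WeierstrassCurve.Projective.X_eq_zero_of_Z_eq_zero h' hz
    have hy : v 1 ≠ 0 := by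
      intro hy
      apply hv
      funext i
      fin_cases i <;> assumption
    refine ⟨.zero, v 1, hy, ?_⟩
    funext i
    fin_cases i <;> simp [homCoords, hx, hz]
  · have := (WeierstrassCurve.Projective.equation_of_Z_ne_zero hz).mp h'
    refine ⟨.some _ _ (WeierstrassCurve.Affine.equation_iff_nonsingular.mp this), v 2, hz, ?_⟩
    funext i
    fin_cases i <;> simp [homCoords, mul_div_cancel₀, hz]

theorem cross_cross_eq_zero_of_dot_eq_zero {v ξ ω : Fin 3 → k} (h1 : ξ ⬝ᵥ v = 0)
    (h2 : ω ⬝ᵥ v = 0) : v ⨯₃ (ξ ⨯₃ ω) = 0 := by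
  simp only [dotProduct, Fin.sum_univ_three] at h1 h2
  funext i
  fin_cases i <;> simp [cross_apply]
  · linear_combination ξ 0 * h2 - ω 0 * h1
  · linear_combination ξ 1 * h2 - ω 1 * h1
  · linear_combination ξ 2 * h2 - ω 2 * h1

end Points

/-! ### The cubic in coordinates adapted to one of its points -/

section Conic

/-- A trilinear form whose restriction to the diagonal is the Weierstrass cubic. -/
def weierstrassTrilinear {S : Type*} [CommRing S] (a : Fin 5 → S) (u v w : Fin 3 → S) : S :=
  u 1 * v 1 * w 2 + a 0 * u 0 * v 1 * w 2 + a 2 * u 1 * v 2 * w 2 -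
    (u 0 * v 0 * w 0 + a 1 * u 0 * v 0 * w 2 + a 3 * u 0 * v 2 * w 2 + a 4 * u 2 * v 2 * w 2)

/-- The sum of the Weierstrass trilinear form over cyclic permutations. -/
def weierstrassCyclic {S : Type*} [CommRing S] (a : Fin 5 → S) (u v w : Fin 3 → S) : S :=
  weierstrassTrilinear a u v w + weierstrassTrilinear a v w u + weierstrassTrilinear a w u v

theorem weierstrassTrilinear_diag {S : Type*} [CommRing S] (a : Fin 5 → S) (p q r v : Fin 3 → S)
    (x y z : S) (hv : v = fun i => x * p i + y * q i + z * r i) :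
    weierstrassTrilinear a v v v =
      x * (weierstrassCyclic a p r r * z ^ 2 + z * (weierstrassCyclic a p p r * x +
        (weierstrassCyclic a p q r + weierstrassCyclic a p r q) * y) +
        (weierstrassTrilinear a p p p * x ^ 2 + weierstrassCyclic a p p q * (x * y) +
          weierstrassCyclic a p q q * y ^ 2)) +
      y * (weierstrassCyclic a q r r * z ^ 2 + weierstrassCyclic a q q r * (z * y) +
        weierstrassTrilinear a q q q * y ^ 2) + weierstrassTrilinear a r r r * z ^ 3 := by
  subst hv
  simp only [weierstrassCyclic, weierstrassTrilinear]
  ring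

theorem map_weierstrassTrilinear {S T : Type*} [CommRing S] [CommRing T] (φ : S →+* T)
    (a : Fin 5 → S) (u v w : Fin 3 → S) :
    weierstrassTrilinear (fun i => φ (a i)) (fun i => φ (u i)) (fun i => φ (v i))
      (fun i => φ (w i)) = φ (weierstrassTrilinear a u v w) := by
  simp [weierstrassTrilinear]

theorem map_weierstrassCyclic {S T : Type*} [CommRing S] [CommRing T] (φ : S →+* T)
    (a : Fin 5 → S) (u v w : Fin 3 → S) :
    weierstrassCyclic (fun i => φ (a i)) (fun i => φ (u i)) (fun i => φ (v i))
      (fun i => φ (w i)) = φ (weierstrassCyclic a u v w) := by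
  simp [weierstrassCyclic, map_weierstrassTrilinear]

variable {k : Type*} [Field k] {E : WeierstrassCurve.Affine k}

/-- The three cross products are, up to the factor `D = det(p, q, r)`, the coordinates dual to the
frame `p, q, r`. Since `r` lies on the cubic, there is no `z ^ 3` term, so what remains modulo `x`
is divisible by `y`. The polarised form gives the expansion without dividing by integers. -/
theorem exists_cubic_expansion (p q r : Fin 3 → k)
    (hr : eval r (WeierstrassCurve.Projective.polynomial E) = 0) :
    ∃ (A : MvPolynomial (Fin 3) k) (a b c : k), A.IsHomogeneous 2 ∧
      C ((p ⬝ᵥ q ⨯₃ r) ^ 3) * WeierstrassCurve.Projective.polynomial E =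
        linForm (q ⨯₃ r) * A + linForm (r ⨯₃ p) * (C a * linForm (p ⨯₃ q) ^ 2 +
          C b * (linForm (p ⨯₃ q) * linForm (r ⨯₃ p)) + C c * linForm (r ⨯₃ p) ^ 2) := by
  set x := linForm (q ⨯₃ r) with hx
  set y := linForm (r ⨯₃ p) with hy
  set z := linForm (p ⨯₃ q) with hz
  set D := p ⬝ᵥ q ⨯₃ r with hD
  have hx1 : x.IsHomogeneous 1 := linForm_isHomogeneous _
  have hy1 : y.IsHomogeneous 1 := linForm_isHomogeneous _
  have hz1 : z.IsHomogeneous 1 := linForm_isHomogeneous _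
  let a : Fin 5 → k := ![E.a₁, E.a₂, E.a₃, E.a₄, E.a₆]
  have hX : (fun i => C D * X i : Fin 3 → MvPolynomial (Fin 3) k) =
      fun i => x * C (p i) + y * C (q i) + z * C (r i) := by
    funext i
    rw [hx, hy, hz, hD]
    fin_cases i <;>
    simp [linForm, Fin.sum_univ_three, cross_apply, dotProduct] <;> ring
  have key := weierstrassTrilinear_diag (fun i => C (a i)) (fun i => C (p i)) (fun i => C (q i))
    (fun i => C (r i)) _ x y z hX
  simp only [map_weierstrassTrilinear, map_weierstrassCyclic] at key
  have hr' : weierstrassTrilinear a r r r = 0 := by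
    rw [← hr, WeierstrassCurve.Projective.eval_polynomial]
    simp [weierstrassTrilinear, a]
    ring
  rw [hr', map_zero, zero_mul, add_zero] at key
  refine ⟨_, _, _, _, ?_, Eq.trans ?_ key⟩
  · have hC : ∀ (c : k) {H : MvPolynomial (Fin 3) k} {n : ℕ}, H.IsHomogeneous n →
        (C c * H).IsHomogeneous n := fun c H n hH => by
      simpa using (isHomogeneous_C (Fin 3) c).mul hH
    refine ((hC _ (hz1.pow 2)).add (hz1.mul ((hC _ hx1).add ?_))).add
      (((hC _ (hx1.pow 2)).add (hC _ (hx1.mul hy1))).add (hC _ (hy1.pow 2)))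
    rw [← map_add]
    exact hC _ hy1
  · simp only [weierstrassTrilinear, WeierstrassCurve.Projective.polynomial, a, map_pow]
    simp
    ring

theorem exists_quadratic_factorization [IsAlgClosed k] {a b c : k}
    (h : a ≠ 0 ∨ b ≠ 0 ∨ c ≠ 0) : ∃ y₁ z₁ y₂ z₂ : k, (y₁ ≠ 0 ∨ z₁ ≠ 0) ∧ (y₂ ≠ 0 ∨ z₂ ≠ 0) ∧
      a = y₁ * y₂ ∧ b = -(z₁ * y₂ + y₁ * z₂) ∧ c = z₁ * z₂ := by
  by_cases ha : a = 0
  · refine ⟨0, 1, -b, c, by simp, ?_, by simp [ha], by simp, by simp⟩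
    simpa [ha] using h
  · obtain ⟨t, ht⟩ := IsAlgClosed.exists_root
      (Polynomial.C a * Polynomial.X ^ 2 + Polynomial.C b * Polynomial.X + Polynomial.C c)
      (by rw [Polynomial.degree_quadratic ha]; decide)
    have ht' : a * t ^ 2 + b * t + c = 0 := by simpa [Polynomial.IsRoot] using ht
    refine ⟨1, t, a, -b - a * t, by simp, by simp [ha], by simp, by ring, ?_⟩
    linear_combination ht'

/-- Differentiating the relation at `P` would make every partial derivative of the cubic vanish
there, against smoothness. -/
theorem false_of_eval_pderiv_eq_zero {ξ : Fin 3 → k} {A B : MvPolynomial (Fin 3) k} {d : k}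
    (hd : d ≠ 0) (hrel : C d * WeierstrassCurve.Projective.polynomial E = linForm ξ * A + B)
    (P : E.Point) (hξ : ξ ⬝ᵥ homCoords P = 0) (hA : eval (homCoords P) A = 0)
    (hB : ∀ i, eval (homCoords P) (pderiv i B) = 0) : False := by
  obtain ⟨i, hi⟩ := exists_eval_pderiv_ne_zero P
  have := congrArg (fun H => eval (homCoords P) (pderiv i H)) hrel
  simp only [map_add, pderiv_mul, map_mul, eval_C, eval_linForm, hξ, hA, hB] at this
  simp [hd, hi] at this

/-- The binary quadratic form in `y, z` splits over `k`. Its roots `(y₁, z₁)` and `(y₂, z₂)` give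
the residual intersections `yᵢ q + zᵢ R` of the line through `q` and `R` with the cubic. -/
theorem exists_conic_relation [IsAlgClosed k] {p q : Fin 3 → k} {R : E.Point}
    (hD : p ⬝ᵥ q ⨯₃ homCoords R ≠ 0) :
    ∃ (A : MvPolynomial (Fin 3) k) (y₁ z₁ y₂ z₂ : k), A.IsHomogeneous 2 ∧
      (y₁ ≠ 0 ∨ z₁ ≠ 0) ∧ (y₂ ≠ 0 ∨ z₂ ≠ 0) ∧
      C ((p ⬝ᵥ q ⨯₃ homCoords R) ^ 3) * WeierstrassCurve.Projective.polynomial E =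
        linForm (q ⨯₃ homCoords R) * A + linForm (homCoords R ⨯₃ p) *
          (linForm (z₁ • homCoords R ⨯₃ p - y₁ • p ⨯₃ q) *
            linForm (z₂ • homCoords R ⨯₃ p - y₂ • p ⨯₃ q)) := by
  obtain ⟨A, a, b, c, hA, hrel⟩ := exists_cubic_expansion p q _ (eval_polynomial_homCoords R)
  have hξ : q ⨯₃ homCoords R ≠ 0 := by
    rintro h
    simp [h] at hD
  -- Otherwise the line `x = 0` would be a component of the cubic. Then `A` vanishes on all of `E`,
  -- in particular at `R`, where the cubic would be singular.
  have habc : a ≠ 0 ∨ b ≠ 0 ∨ c ≠ 0 := by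
    by_contra hcon
    push Not at hcon
    obtain ⟨rfl, rfl, rfl⟩ := hcon
    simp only [map_zero, zero_mul, add_zero, mul_zero] at hrel
    have h0 := congrArg (aeval (genericCoords E)) hrel
    rw [map_mul, map_mul, aeval_genericCoords_polynomial, mul_zero, eq_comm, mul_eq_zero] at h0
    have hAR := eval_homCoords_eq_zero hA (h0.resolve_left (lin_ne_zero hξ)) R
    exact false_of_eval_pderiv_eq_zero (B := 0) (pow_ne_zero 3 hD) (by rw [hrel, add_zero]) R
      (by rw [dotProduct_comm, dot_cross_self]) hAR (by simp)
  obtain ⟨y₁, z₁, y₂, z₂, h1, h2, rfl, rfl, rfl⟩ := exists_quadratic_factorization habc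
  refine ⟨A, y₁, z₁, y₂, z₂, hA, h1, h2, hrel.trans ?_⟩
  simp only [sub_eq_add_neg, linForm_add, linForm_neg, linForm_smul, map_add, map_mul, map_neg]
  ring

end Conic

/-! ### Multiplicities of the zeros of a projection -/

section Multiplicity

variable {k : Type*} [Field k] {E : WeierstrassCurve.Affine k}

theorem aeval_linForm (ξ : Fin 3 → k) : aeval (genericCoords E) (linForm ξ) = lin E ξ := rfl

/-- The lines `ξ` and `ω₁` generate the maximal ideal, and `ξ = -η ω₁ ω₂ / A` is a multiple of `ω₁`
when `A(P) ≠ 0`. So `ω₁` alone, divided by a coordinate not vanishing at `P`, is a uniformizer. -/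
theorem exists_uniformizer_of_regular {P : E.Point} {ξ η ω₁ ω₂ : Fin 3 → k}
    {A : MvPolynomial (Fin 3) k} (hA : A.IsHomogeneous 2)
    (hrel : lin E ξ * aeval (genericCoords E) A + lin E η * (lin E ω₁ * lin E ω₂) = 0)
    (hω : ω₁ ⬝ᵥ homCoords P = 0) {c : k} (hc : c ≠ 0) (hcross : ξ ⨯₃ ω₁ = c • homCoords P)
    (hA0 : eval (homCoords P) A ≠ 0) : ∃ (t : localRing P) (N : Fin 3 → k),
      t ∈ vanishingIdeal P ∧ t ≠ 0 ∧ vanishingIdeal P ≤ Ideal.span {t} ∧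
      N ⬝ᵥ homCoords P ≠ 0 ∧ (t : E.FunctionField) * lin E N = lin E ω₁ := by
  obtain ⟨i, hi⟩ := Function.ne_iff.mp (homCoords_ne_zero P)
  set N : Fin 3 → k := Pi.single i 1 with hN
  have hNP : N ⬝ᵥ homCoords P ≠ 0 := by simpa [hN] using hi
  have hN0 : lin E N ≠ 0 :=
    aeval_ne_zero (linForm_isHomogeneous N) (P := P) (by rwa [eval_linForm])
  have hAg := aeval_ne_zero hA hA0
  have hω0 : ω₁ ≠ 0 := by
    rintro rfl
    rw [map_zero, eq_comm, smul_eq_zero] at hcross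
    exact hcross.elim hc (homCoords_ne_zero P)
  refine ⟨linQuot P ω₁ N hNP, N, ⟨1, linForm ω₁, linForm N, isQuotient_div
    (linForm_isHomogeneous _) (linForm_isHomogeneous _) hN0, by rwa [eval_linForm],
    by rwa [eval_linForm]⟩, ?_, ?_, hNP, div_mul_cancel₀ _ hN0⟩
  · intro h0
    exact div_ne_zero (lin_ne_zero hω0) hN0 (congrArg Subtype.val h0)
  · refine (vanishingIdeal_le_span hc hcross hNP).trans (Ideal.span_le.mpr ?_)
    rintro _ (rfl | rfl)
    · have hmem : -(lin E η * lin E ω₂) / aeval (genericCoords E) A ∈ localRing P := by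
        have := div_mem_localRing (E := E) (F := -(linForm η * linForm ω₂)) (n := 2)
          ((linForm_isHomogeneous η).mul (linForm_isHomogeneous ω₂)).neg hA hA0
        simpa [lin] using this
      refine Ideal.mem_span_singleton'.mpr ⟨⟨_, hmem⟩, Subtype.ext ?_⟩
      simp only [linQuot, Subring.coe_mul]
      field_simp
      linear_combination -hrel
    · exact Ideal.subset_span rfl

theorem zeroMultiplicity_eq_one_of_regular {P : E.Point} {ξ η ω₁ ω₂ : Fin 3 → k}
    {A : MvPolynomial (Fin 3) k} (hA : A.IsHomogeneous 2)
    (hrel : lin E ξ * aeval (genericCoords E) A + lin E η * (lin E ω₁ * lin E ω₂) = 0)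
    {f : E.FunctionField} (hf : f * aeval (genericCoords E) A = -(lin E ω₁ * lin E ω₂))
    (hω : ω₁ ⬝ᵥ homCoords P = 0) (hω₂ : ω₂ ⬝ᵥ homCoords P ≠ 0)
    {c : k} (hc : c ≠ 0) (hcross : ξ ⨯₃ ω₁ = c • homCoords P)
    (hA0 : eval (homCoords P) A ≠ 0) : zeroMultiplicity f P = 1 := by
  obtain ⟨t, N, ht, ht0, hspan, hN, htN⟩ := exists_uniformizer_of_regular hA hrel hω hc hcross hA0
  have hAg := aeval_ne_zero hA hA0
  have hF : (-(linForm ω₂ * linForm N)).IsHomogeneous 2 :=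
    ((linForm_isHomogeneous ω₂).mul (linForm_isHomogeneous N)).neg
  have := zeroMultiplicity_eq_of_uniformizer (w := ⟨_, div_mem_localRing hF hA hA0⟩) 1 ht ht0 hspan
    (notMem_vanishingIdeal (isQuotient_div hF hA hAg) (by simp [eval_linForm, hω₂, hN])) (f := f) (by
      simp only [map_neg, map_mul]
      rw [eq_div_of_mul_eq hAg hf, ← htN, ← lin, ← lin]
      ring)
  simpa using this

-- On `E` the function `ξ / η` equals `-ω₁ ω₂ / A`. If `A(P) ≠ 0`, a vanishing `ωᵢ` is a uniformizer
-- and the zeros are counted on the right-hand form; `h12` covers a double zero. If `A(P) = 0`,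
-- smoothness lets exactly one of `η`, `ω₁`, `ω₂` vanish at `P`: for `η` there is no zero, and for
-- `ωᵢ` the function `ξ / η` is itself a uniformizer.
open Classical in
theorem zeroMultiplicity_of_relation {P : E.Point} {ξ η ω₁ ω₂ : Fin 3 → k}
    {A : MvPolynomial (Fin 3) k} {d : k} (hA : A.IsHomogeneous 2) (hd : d ≠ 0) (hη : η ≠ 0)
    (hrel : C d * WeierstrassCurve.Projective.polynomial E =
      linForm ξ * A + linForm η * (linForm ω₁ * linForm ω₂))
    (h1 : ξ ⬝ᵥ homCoords P = 0 → ω₁ ⬝ᵥ homCoords P = 0 → ∃ c : k, c ≠ 0 ∧ ξ ⨯₃ ω₁ = c • homCoords P)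
    (h2 : ξ ⬝ᵥ homCoords P = 0 → ω₂ ⬝ᵥ homCoords P = 0 → ∃ c : k, c ≠ 0 ∧ ξ ⨯₃ ω₂ = c • homCoords P)
    (h12 : ξ ⬝ᵥ homCoords P = 0 → ω₁ ⬝ᵥ homCoords P = 0 → ω₂ ⬝ᵥ homCoords P = 0 →
      ∃ c : k, c ≠ 0 ∧ ω₂ = c • ω₁) :
    zeroMultiplicity (lin E ξ / lin E η) P =
      (if ξ ⬝ᵥ homCoords P = 0 ∧ ω₁ ⬝ᵥ homCoords P = 0 then 1 else 0) +
        (if ξ ⬝ᵥ homCoords P = 0 ∧ ω₂ ⬝ᵥ homCoords P = 0 then 1 else 0) := by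
  have hη0 : lin E η ≠ 0 := lin_ne_zero hη
  have hq : IsQuotient (lin E ξ / lin E η) 1 (linForm ξ) (linForm η) :=
    isQuotient_div (linForm_isHomogeneous _) (linForm_isHomogeneous _) hη0
  by_cases hξ : ξ ⬝ᵥ homCoords P = 0
  swap
  · simp only [hξ, false_and, if_false, add_zero]
    exact zeroMultiplicity_eq_zero hq (by rwa [eval_linForm])
  have hg : lin E ξ * aeval (genericCoords E) A + lin E η * (lin E ω₁ * lin E ω₂) = 0 := by
    have := congrArg (aeval (genericCoords E)) hrel
    rw [map_mul, aeval_genericCoords_polynomial, mul_zero] at this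
    simpa [lin] using this.symm
  have hf : lin E ξ / lin E η * aeval (genericCoords E) A = -(lin E ω₁ * lin E ω₂) := by
    field_simp
    linear_combination hg
  have hq2 : IsQuotient (lin E ξ / lin E η) 2 (-(linForm ω₁ * linForm ω₂)) A :=
    ⟨((linForm_isHomogeneous ω₁).mul (linForm_isHomogeneous ω₂)).neg, hA, by simpa [lin] using hf⟩
  have hg' : lin E ξ * aeval (genericCoords E) A + lin E η * (lin E ω₂ * lin E ω₁) = 0 := by
    rw [mul_comm (lin E ω₂), hg]
  have hf' : lin E ξ / lin E η * aeval (genericCoords E) A = -(lin E ω₂ * lin E ω₁) := by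
    rw [mul_comm (lin E ω₂), hf]
  by_cases hA0 : eval (homCoords P) A = 0
  · -- smoothness of the curve: only one of the three linear forms vanishes at the point
    have hprod : η ⬝ᵥ homCoords P * (ω₁ ⬝ᵥ homCoords P * ω₂ ⬝ᵥ homCoords P) = 0 := by
      have := congrArg (eval (homCoords P)) hrel
      simp only [map_mul, map_add, eval_polynomial_homCoords, eval_linForm, hξ, hA0, mul_zero,
        zero_add] at this
      exact this.symm
    have hsm : (η ⬝ᵥ homCoords P = 0 ∧ ω₁ ⬝ᵥ homCoords P = 0 ∨
        η ⬝ᵥ homCoords P = 0 ∧ ω₂ ⬝ᵥ homCoords P = 0 ∨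
        ω₁ ⬝ᵥ homCoords P = 0 ∧ ω₂ ⬝ᵥ homCoords P = 0) → False := fun h =>
      false_of_eval_pderiv_eq_zero hd hrel P hξ hA0 fun i => by
        simp only [pderiv_mul, map_add, map_mul, eval_linForm, pderiv_linForm, eval_C]
        rcases h with ⟨h, h'⟩ | ⟨h, h'⟩ | ⟨h, h'⟩ <;> simp [h, h']
    have hone : ∀ ω ω' : Fin 3 → k, lin E ξ / lin E η * aeval (genericCoords E) A =
        -(lin E ω * lin E ω') → ω ⬝ᵥ homCoords P = 0 → ω' ⬝ᵥ homCoords P ≠ 0 →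
        η ⬝ᵥ homCoords P ≠ 0 → (∃ c : k, c ≠ 0 ∧ ξ ⨯₃ ω = c • homCoords P) →
        zeroMultiplicity (lin E ξ / lin E η) P = 1 := by
      rintro ω ω' hfω hω hω' hηP ⟨c, hc, hcross⟩
      have hξ0 : ξ ≠ 0 := by
        rintro rfl
        rw [map_zero, LinearMap.zero_apply, eq_comm, smul_eq_zero] at hcross
        exact hcross.elim hc (homCoords_ne_zero P)
      have hspan : vanishingIdeal P ≤ Ideal.span {linQuot P ξ η hηP} := by
        refine (vanishingIdeal_le_span hc hcross hηP).trans (Ideal.span_le.mpr ?_)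
        rintro _ (rfl | rfl)
        · exact Ideal.subset_span rfl
        · have hG : (linForm η * linForm ω').IsHomogeneous 2 :=
            (linForm_isHomogeneous η).mul (linForm_isHomogeneous ω')
          have hmem := div_mem_localRing (E := E) (P := P) hA.neg hG (by
            simp [eval_linForm, hηP, hω'])
          have hω'0 : lin E ω' ≠ 0 :=
            aeval_ne_zero (linForm_isHomogeneous ω') (P := P) (by rwa [eval_linForm])
          refine Ideal.mem_span_singleton'.mpr ⟨⟨_, hmem⟩, Subtype.ext ?_⟩
          simp only [linQuot, Subring.coe_mul, map_neg, map_mul]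
          rw [← lin, ← lin]
          have : lin E ω = -(lin E ξ / lin E η * aeval (genericCoords E) A) / lin E ω' := by
            rw [hfω]; field_simp
          rw [this]
          field_simp
      have := zeroMultiplicity_eq_of_uniformizer (t := linQuot P ξ η hηP) (w := 1) 1
        ⟨1, linForm ξ, linForm η, hq, by rwa [eval_linForm], by rwa [eval_linForm]⟩
        (fun h0 => div_ne_zero (lin_ne_zero hξ0) hη0 (congrArg Subtype.val h0)) hspan
        (notMem_vanishingIdeal (n := 0) (F := 1) (G := 1)
          ⟨isHomogeneous_one _ _, isHomogeneous_one _ _, by simp⟩ (by simp))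
        (f := lin E ξ / lin E η) (by simp [linQuot])
      simpa using this
    by_cases hηP : η ⬝ᵥ homCoords P = 0
    · have hω₁ : ω₁ ⬝ᵥ homCoords P ≠ 0 := fun h => hsm (Or.inl ⟨hηP, h⟩)
      have hω₂ : ω₂ ⬝ᵥ homCoords P ≠ 0 := fun h => hsm (Or.inr (Or.inl ⟨hηP, h⟩))
      simp only [hω₁, hω₂, and_false, if_false, add_zero]
      exact zeroMultiplicity_eq_zero hq2 (by simp [eval_linForm, hω₁, hω₂])
    · by_cases hω₁ : ω₁ ⬝ᵥ homCoords P = 0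
      · have hω₂ : ω₂ ⬝ᵥ homCoords P ≠ 0 := fun h => hsm (Or.inr (Or.inr ⟨hω₁, h⟩))
        simpa [hω₁, hω₂, hξ] using hone ω₁ ω₂ hf hω₁ hω₂ hηP (h1 hξ hω₁)
      · have hω₂ : ω₂ ⬝ᵥ homCoords P = 0 := by simpa [hηP, hω₁] using hprod
        simpa [hω₁, hω₂, hξ] using hone ω₂ ω₁ hf' hω₂ hω₁ hηP (h2 hξ hω₂)
  · have hAg := aeval_ne_zero hA hA0
    by_cases hω₁ : ω₁ ⬝ᵥ homCoords P = 0
    · obtain ⟨c, hc, hcross⟩ := h1 hξ hω₁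
      by_cases hω₂ : ω₂ ⬝ᵥ homCoords P = 0
      · obtain ⟨c', hc', rfl⟩ := h12 hξ hω₁ hω₂
        obtain ⟨t, N, ht, ht0, hspan, hN, htN⟩ :=
          exists_uniformizer_of_regular hA hg hω₁ hc hcross hA0
        have hF : (-(C c' * (linForm N * linForm N))).IsHomogeneous 2 := by
          have := (isHomogeneous_C (Fin 3) c').mul
            ((linForm_isHomogeneous N).mul (linForm_isHomogeneous N))
          simpa using this.neg
        have := zeroMultiplicity_eq_of_uniformizer (w := ⟨_, div_mem_localRing hF hA hA0⟩) 2 ht ht0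
          hspan (notMem_vanishingIdeal (isQuotient_div hF hA hAg)
            (by simp [eval_linForm, hc', hN])) (f := lin E ξ / lin E η) (by
            simp only [map_neg, map_mul, aeval_C]
            rw [eq_div_of_mul_eq hAg hf, ← lin, lin_smul, ← htN]
            ring)
        rw [this]
        simp only [hξ, hω₁, hω₂, and_self, if_true]
        norm_num
      · simpa [hω₁, hω₂, hξ] using
          zeroMultiplicity_eq_one_of_regular hA hg hf hω₁ hω₂ hc hcross hA0
    · by_cases hω₂ : ω₂ ⬝ᵥ homCoords P = 0
      · obtain ⟨c, hc, hcross⟩ := h2 hξ hω₂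
        simpa [hω₁, hω₂, hξ] using
          zeroMultiplicity_eq_one_of_regular hA hg' hf' hω₂ hω₁ hc hcross hA0
      · simp only [hω₁, hω₂, and_false, if_false, add_zero]
        exact zeroMultiplicity_eq_zero hq2 (by simp [eval_linForm, hω₁, hω₂])

end Multiplicity

/-! ### Projection from a point has degree two and is defined everywhere -/

section Degree

variable {k : Type*} [Field k] {E : WeierstrassCurve.Affine k}

theorem cross_cross_frame (p q r : Fin 3 → k) (y z : k) :
    (q ⨯₃ r) ⨯₃ (z • r ⨯₃ p - y • p ⨯₃ q) = (p ⬝ᵥ q ⨯₃ r) • (y • q + z • r) := by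
  funext i
  fin_cases i <;> simp [cross_apply, dotProduct, Fin.sum_univ_three] <;> ring

theorem cross_dot_smul_add_smul (q r : Fin 3 → k) (y z : k) :
    (q ⨯₃ r) ⬝ᵥ (y • q + z • r) = 0 := by
  simp [cross_apply, dotProduct, Fin.sum_univ_three]; ring

theorem pencil_dot_smul_add_smul (p q r : Fin 3 → k) (y z : k) :
    (z • r ⨯₃ p - y • p ⨯₃ q) ⬝ᵥ (y • q + z • r) = 0 := by
  simp [cross_apply, dotProduct, Fin.sum_univ_three]; ring

theorem cross_ne_zero_of_frame {p q r : Fin 3 → k} (hD : p ⬝ᵥ q ⨯₃ r ≠ 0) :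
    q ⨯₃ r ≠ 0 ∧ r ⨯₃ p ≠ 0 := by
  constructor
  · intro h
    simp [h] at hD
  · intro h
    rw [triple_product_permutation] at hD
    simp [h] at hD

theorem smul_add_smul_ne_zero_of_frame {p q r : Fin 3 → k} (hD : p ⬝ᵥ q ⨯₃ r ≠ 0) {y z : k}
    (h : y ≠ 0 ∨ z ≠ 0) : y • q + z • r ≠ 0 := by
  intro h0
  have h1 : (r ⨯₃ p) ⬝ᵥ (y • q + z • r) = y * (p ⬝ᵥ q ⨯₃ r) := by
    simp [cross_apply, dotProduct, Fin.sum_univ_three]; ring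
  have h2 : (p ⨯₃ q) ⬝ᵥ (y • q + z • r) = z * (p ⬝ᵥ q ⨯₃ r) := by
    simp [cross_apply, dotProduct, Fin.sum_univ_three]; ring
  rw [h0, dotProduct_zero, eq_comm, mul_eq_zero] at h1 h2
  exact h.elim (fun h => h (h1.resolve_right hD)) (fun h => h (h2.resolve_right hD))

open Classical in
theorem exists_zeros_of_frame [IsAlgClosed k] [E.IsElliptic] {p q : Fin 3 → k} {R : E.Point}
    (hD : p ⬝ᵥ q ⨯₃ homCoords R ≠ 0) :
    ∃ P₁ P₂ : E.Point, ∀ P, zeroMultiplicity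
      (lin E (q ⨯₃ homCoords R) / lin E (homCoords R ⨯₃ p)) P =
        (if P = P₁ then 1 else 0) + (if P = P₂ then 1 else 0) := by
  obtain ⟨A, y₁, z₁, y₂, z₂, hA, h1, h2, hrel⟩ := exists_conic_relation hD
  set r := homCoords R
  obtain ⟨-, hη⟩ := cross_ne_zero_of_frame hD
  have hξv := cross_dot_smul_add_smul q r
  have hωv := pencil_dot_smul_add_smul p q r
  have hpt : ∀ y z : k, (y ≠ 0 ∨ z ≠ 0) → eval (y • q + z • r)
      (WeierstrassCurve.Projective.polynomial E) = 0 → ∃ Q : E.Point,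
      (∃ c : k, c ≠ 0 ∧ y • q + z • r = c • homCoords Q) ∧ ∀ P : E.Point,
        ((q ⨯₃ r) ⬝ᵥ homCoords P = 0 ∧ (z • r ⨯₃ p - y • p ⨯₃ q) ⬝ᵥ homCoords P = 0) ↔ P = Q := by
    intro y z h0 hW
    have hne := smul_add_smul_ne_zero_of_frame hD h0
    obtain ⟨Q, c, hc, hQ⟩ := exists_point_of_eval_polynomial_eq_zero hne hW
    refine ⟨Q, ⟨c, hc, hQ⟩, fun P => ⟨fun ⟨ha, hb⟩ => ?_, ?_⟩⟩
    · have := cross_cross_eq_zero_of_dot_eq_zero ha hb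
      rw [cross_cross_frame, hQ, map_smul, map_smul, smul_eq_zero, smul_eq_zero] at this
      exact eq_of_cross_eq_zero ((this.resolve_left hD).resolve_left hc)
    · rintro rfl
      have ha := hξv y z
      have hb := hωv y z
      rw [hQ, dotProduct_smul, smul_eq_mul, mul_eq_zero] at ha hb
      exact ⟨ha.resolve_left hc, hb.resolve_left hc⟩
  have hW : ∀ v, (q ⨯₃ r) ⬝ᵥ v = 0 → ((z₁ • r ⨯₃ p - y₁ • p ⨯₃ q) ⬝ᵥ v = 0 ∨
      (z₂ • r ⨯₃ p - y₂ • p ⨯₃ q) ⬝ᵥ v = 0) →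
      eval v (WeierstrassCurve.Projective.polynomial E) = 0 := by
    intro v hv hor
    have := congrArg (eval v) hrel
    simp only [map_mul, map_add, eval_linForm, eval_C, hv] at this
    have h0 : (p ⬝ᵥ q ⨯₃ r) ^ 3 * eval v (WeierstrassCurve.Projective.polynomial E) = 0 := by
      rw [this]
      rcases hor with h | h <;> simp [h]
    exact (mul_eq_zero.mp h0).resolve_left (pow_ne_zero 3 hD)
  obtain ⟨P₁, ⟨c₁, hc₁, hv₁⟩, hP₁⟩ := hpt y₁ z₁ h1 (hW _ (hξv _ _) (Or.inl (hωv _ _)))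
  obtain ⟨P₂, ⟨c₂, hc₂, hv₂⟩, hP₂⟩ := hpt y₂ z₂ h2 (hW _ (hξv _ _) (Or.inr (hωv _ _)))
  refine ⟨P₁, P₂, fun P => ?_⟩
  have := zeroMultiplicity_of_relation (P := P) hA (pow_ne_zero 3 hD) hη hrel
    (fun ha hb => by
      obtain rfl := (hP₁ P).mp ⟨ha, hb⟩
      exact ⟨(p ⬝ᵥ q ⨯₃ r) * c₁, mul_ne_zero hD hc₁, by rw [cross_cross_frame, hv₁, smul_smul]⟩)
    (fun ha hb => by
      obtain rfl := (hP₂ P).mp ⟨ha, hb⟩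
      exact ⟨(p ⬝ᵥ q ⨯₃ r) * c₂, mul_ne_zero hD hc₂, by rw [cross_cross_frame, hv₂, smul_smul]⟩)
    (fun ha hb hb' => by
      obtain rfl := (hP₁ P).mp ⟨ha, hb⟩
      obtain rfl := (hP₂ P).mp ⟨ha, hb'⟩
      refine ⟨c₁⁻¹ * c₂, mul_ne_zero (inv_ne_zero hc₁) hc₂, ?_⟩
      -- Both residual vectors represent the same point `P`, hence are proportional. Independence of
      -- `q` and `R` transfers this to the pairs `(yᵢ, zᵢ)`.
      have hdiff : (c₁ * y₂ - c₂ * y₁) • q + (c₁ * z₂ - c₂ * z₁) • r = 0 := by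
        calc _ = c₁ • (y₂ • q + z₂ • r) - c₂ • (y₁ • q + z₁ • r) := by module
          _ = 0 := by rw [hv₁, hv₂, smul_comm, sub_self]
      have hyz : c₁ * y₂ - c₂ * y₁ = 0 ∧ c₁ * z₂ - c₂ * z₁ = 0 := by
        by_contra hcon
        exact smul_add_smul_ne_zero_of_frame hD (by tauto) hdiff
      have hy : y₂ = c₁⁻¹ * c₂ * y₁ := by field_simp; linear_combination hyz.1
      have hz : z₂ = c₁⁻¹ * c₂ * z₁ := by field_simp; linear_combination hyz.2
      rw [hy, hz]
      module)
  rw [this]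
  simp only [hP₁, hP₂]

theorem degree_eq_two_of_frame [IsAlgClosed k] [E.IsElliptic] {p q : Fin 3 → k} {R : E.Point}
    (hD : p ⬝ᵥ q ⨯₃ homCoords R ≠ 0) :
    degree (lin E (q ⨯₃ homCoords R) / lin E (homCoords R ⨯₃ p)) = 2 := by
  classical
  obtain ⟨P₁, P₂, h⟩ := exists_zeros_of_frame hD
  rw [degree]
  simp only [h]
  rw [((hasSum_ite_eq P₁ (1 : ℕ∞)).add (hasSum_ite_eq P₂ 1)).tsum_eq]
  norm_num

theorem not_three_zeros_of_frame [IsAlgClosed k] [E.IsElliptic] {p q : Fin 3 → k} {R : E.Point}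
    (hD : p ⬝ᵥ q ⨯₃ homCoords R ≠ 0) {S : Fin 3 → E.Point} (hS : Function.Injective S)
    (h : ∀ i, ∃ n F G, IsQuotient (lin E (q ⨯₃ homCoords R) / lin E (homCoords R ⨯₃ p)) n F G ∧
      eval (homCoords (S i)) F = 0 ∧ eval (homCoords (S i)) G ≠ 0) : False := by
  classical
  obtain ⟨P₁, P₂, hz⟩ := exists_zeros_of_frame hD
  have hmem : ∀ i, S i = P₁ ∨ S i = P₂ := fun i => by
    obtain ⟨n, F, G, hq, hF, hG⟩ := h i
    have := one_le_zeroMultiplicity hq hF hG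
    rw [hz] at this
    by_contra hcon
    push Not at hcon
    simp [hcon.1, hcon.2] at this
  have e01 : S 0 ≠ S 1 := hS.ne (by decide)
  have e02 : S 0 ≠ S 2 := hS.ne (by decide)
  have e12 : S 1 ≠ S 2 := hS.ne (by decide)
  rcases hmem 0 with h0 | h0 <;> rcases hmem 1 with h1 | h1 <;> rcases hmem 2 with h2 | h2 <;>
    simp_all

/-- At the centre `R` both linear forms vanish and the second representation `-ω₁ ω₂ / A` is used.
If it were indeterminate as well, the cubic would be singular there. -/
theorem exists_isQuotient_of_frame [IsAlgClosed k] {p q : Fin 3 → k} {R : E.Point}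
    (hD : p ⬝ᵥ q ⨯₃ homCoords R ≠ 0) (P : E.Point) : ∃ n F G,
      IsQuotient (lin E (q ⨯₃ homCoords R) / lin E (homCoords R ⨯₃ p)) n F G ∧
      (eval (homCoords P) F ≠ 0 ∨ eval (homCoords P) G ≠ 0) := by
  obtain ⟨hξ, hη⟩ := cross_ne_zero_of_frame hD
  by_cases h : (q ⨯₃ homCoords R) ⬝ᵥ homCoords P ≠ 0 ∨ (homCoords R ⨯₃ p) ⬝ᵥ homCoords P ≠ 0
  · exact ⟨1, _, _, isQuotient_div (linForm_isHomogeneous _) (linForm_isHomogeneous _)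
      (lin_ne_zero hη), by simpa only [eval_linForm] using h⟩
  push Not at h
  obtain ⟨A, y₁, z₁, y₂, z₂, hA, -, -, hrel⟩ := exists_conic_relation hD
  refine ⟨2, -(linForm _ * linForm _), A, ⟨((linForm_isHomogeneous
    (z₁ • homCoords R ⨯₃ p - y₁ • p ⨯₃ q)).mul (linForm_isHomogeneous
    (z₂ • homCoords R ⨯₃ p - y₂ • p ⨯₃ q))).neg, hA, ?_⟩, ?_⟩
  · have := congrArg (aeval (genericCoords E)) hrel
    rw [map_mul, aeval_genericCoords_polynomial, mul_zero] at this
    have hη0 := lin_ne_zero (E := E) hη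
    simp only [map_add, map_mul, aeval_linForm, map_neg] at this ⊢
    field_simp
    linear_combination -this
  · by_contra hcon
    push Not at hcon
    refine false_of_eval_pderiv_eq_zero (pow_ne_zero 3 hD) hrel P h.1 hcon.2 fun i => ?_
    have h1 := hcon.1
    simp only [map_neg, map_mul, eval_linForm, neg_eq_zero] at h1
    simp only [pderiv_mul, map_add, map_mul, eval_linForm, pderiv_linForm, eval_C, h1, h.2]
    ring

end Degree

/-! ### Collinearity of points on the cubic -/

section Collinear

variable {k : Type*} [Field k] {E : WeierstrassCurve.Affine k}

/-- The determinant of the homogeneous coordinates of three points: it vanishes exactly when the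
points are collinear. -/
def det₃ (P Q S : E.Point) : k := homCoords P ⬝ᵥ homCoords Q ⨯₃ homCoords S

theorem det₃_swap_left (P Q S : E.Point) : det₃ Q P S = -det₃ P Q S := by
  simp [det₃, cross_apply, dotProduct, Fin.sum_univ_three]; ring

theorem det₃_swap_right (P Q S : E.Point) : det₃ P S Q = -det₃ P Q S := by
  simp [det₃, cross_apply, dotProduct, Fin.sum_univ_three]; ring

theorem det₃_rotate (P Q S : E.Point) : det₃ Q S P = det₃ P Q S := by
  rw [det₃_swap_right, det₃_swap_left, neg_neg]

theorem cross_dot_homCoords (P Q S : E.Point) :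
    (homCoords P ⨯₃ homCoords Q) ⬝ᵥ homCoords S = det₃ P Q S := by
  simp [det₃, cross_apply, dotProduct, Fin.sum_univ_three]; ring

theorem det₃_self_left (P Q : E.Point) : det₃ P P Q = 0 := by simp [det₃]

theorem det₃_self_right (P Q : E.Point) : det₃ P Q Q = 0 := by simp [det₃]

theorem det₃_self_outer (P Q : E.Point) : det₃ P Q P = 0 := by
  rw [det₃_swap_right, det₃_self_left, neg_zero]

theorem cross_homCoords_ne_zero {P Q : E.Point} (h : P ≠ Q) : homCoords P ⨯₃ homCoords Q ≠ 0 :=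
  fun h0 => h (eq_of_cross_eq_zero h0)

theorem eq_of_frame_dot_eq_zero {p q : Fin 3 → k} {R P : E.Point}
    (hD : p ⬝ᵥ q ⨯₃ homCoords R ≠ 0) (h1 : (q ⨯₃ homCoords R) ⬝ᵥ homCoords P = 0)
    (h2 : (homCoords R ⨯₃ p) ⬝ᵥ homCoords P = 0) : P = R := by
  have h := cross_cross_eq_zero_of_dot_eq_zero h1 h2
  have e : (q ⨯₃ homCoords R) ⨯₃ (homCoords R ⨯₃ p) = (p ⬝ᵥ q ⨯₃ homCoords R) • homCoords R := by
    funext i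
    fin_cases i <;> simp [cross_apply, dotProduct, Fin.sum_univ_three] <;> ring
  rw [e, map_smul, smul_eq_zero] at h
  exact eq_of_cross_eq_zero (h.resolve_left hD)

theorem exists_smul_add_smul_of_det₃_eq_zero {P Q S : E.Point} (hPQ : P ≠ Q) (h : det₃ P Q S = 0) :
    ∃ m n : k, homCoords S = m • homCoords P + n • homCoords Q := by
  obtain ⟨i, hi⟩ := Function.ne_iff.mp (cross_homCoords_ne_zero hPQ)
  have hi' : (homCoords P ⨯₃ homCoords Q) i ≠ 0 := hi
  refine ⟨((homCoords P ⨯₃ homCoords Q) i)⁻¹ * (homCoords S ⨯₃ homCoords Q) i,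
    ((homCoords P ⨯₃ homCoords Q) i)⁻¹ * (homCoords P ⨯₃ homCoords S) i, ?_⟩
  simp only [det₃, cross_apply, dotProduct, Fin.sum_univ_three] at h
  funext j
  simp only [Pi.add_apply, Pi.smul_apply, smul_eq_mul]
  field_simp
  fin_cases i <;> fin_cases j <;> simp [cross_apply] at h ⊢ <;> first | ring1 | linear_combination h

/-- A line through `R` and three further points of `E` would give the projection from `R` three
distinct zeros. -/
theorem not_collinear [IsAlgClosed k] [E.IsElliptic] {R S₁ S₂ S₃ : E.Point} (h1 : S₁ ≠ R)
    (h2 : S₂ ≠ R) (h3 : S₃ ≠ R) (h12 : S₁ ≠ S₂) (h13 : S₁ ≠ S₃) (h23 : S₂ ≠ S₃)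
    (hc2 : det₃ S₂ S₁ R = 0) (hc3 : det₃ S₃ S₁ R = 0) : False := by
  -- The third frame vector is arbitrary off the line; a standard basis vector serves.
  obtain ⟨i, hi⟩ := Function.ne_iff.mp (cross_homCoords_ne_zero h1)
  have hD : (Pi.single i 1 : Fin 3 → k) ⬝ᵥ homCoords S₁ ⨯₃ homCoords R ≠ 0 := by simpa using hi
  have hξ : ∀ j, (homCoords S₁ ⨯₃ homCoords R) ⬝ᵥ homCoords (![S₁, S₂, S₃] j) = 0 := by
    intro j
    rw [dotProduct_comm]
    fin_cases j
    exacts [det₃_self_left _ _, hc2, hc3]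
  refine not_three_zeros_of_frame hD (S := ![S₁, S₂, S₃]) ?_ fun j => ⟨1, _, _, isQuotient_div
    (linForm_isHomogeneous _) (linForm_isHomogeneous _)
    (lin_ne_zero (cross_ne_zero_of_frame hD).2), ?_, ?_⟩
  · intro j j' h
    fin_cases j <;> fin_cases j' <;> simp_all
  · rw [eval_linForm, hξ]
  · rw [eval_linForm]
    intro h0
    have := eq_of_frame_dot_eq_zero hD (hξ j) h0
    fin_cases j
    exacts [h1 this, h2 this, h3 this]

end Collinear

/-! ### Adjusting a projection by a Möbius map -/

section Moebius

variable {k : Type*} [Field k] {E : WeierstrassCurve.Affine k}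

/-- The determinant of two vectors of the plane. -/
def det₂ (u v : Fin 2 → k) : k := u 0 * v 1 - u 1 * v 0

theorem det₂_ne_zero {u v : Fin 2 → k} (hu : u ≠ 0) (hv : v ≠ 0)
    (h : Projectivization.mk k u hu ≠ Projectivization.mk k v hv) : det₂ u v ≠ 0 := by
  intro h0
  apply h
  rw [Projectivization.mk_eq_mk_iff']
  simp only [det₂] at h0
  by_cases hv0 : v 0 = 0
  · have hv1 : v 1 ≠ 0 := fun h1 => hv (by funext i; fin_cases i <;> assumption)
    have hu0 : u 0 = 0 := by simpa [hv0, hv1] using h0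
    refine ⟨u 1 / v 1, ?_⟩
    funext i
    fin_cases i <;> simp [hv0, hu0, hv1]
  · refine ⟨u 0 / v 0, ?_⟩
    funext i
    fin_cases i
    · simp [hv0]
    · simp
      field_simp
      linear_combination h0

theorem hasValueAt_mk {f : E.FunctionField} {P : E.Point} {n : ℕ} {F G : MvPolynomial (Fin 3) k}
    (h : IsQuotient f n F G) {w : Fin 2 → k} (hw : w ≠ 0) {μ : k} (hμ : μ ≠ 0)
    (h0 : eval (homCoords P) F = μ * w 0) (h1 : eval (homCoords P) G = μ * w 1) :
    HasValueAt f P (Projectivization.mk k w hw) := by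
  have e : ![eval (homCoords P) F, eval (homCoords P) G] = μ • w := by
    funext i
    fin_cases i <;> simp [h0, h1]
  refine ⟨n, F, G, h, by rw [e]; exact smul_ne_zero hμ hw, ?_⟩
  rw [Projectivization.mk_eq_mk_iff']
  exact ⟨μ, e.symm⟩

theorem IsQuotient.moebius {x y : E.FunctionField} (hy : y ≠ 0) {n : ℕ}
    {F G : MvPolynomial (Fin 3) k} (h : IsQuotient (x / y) n F G) (a b c d : k)
    (h0 : algebraMap k _ c * x + algebraMap k _ d * y ≠ 0) :
    IsQuotient ((algebraMap k _ a * x + algebraMap k _ b * y) /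
      (algebraMap k _ c * x + algebraMap k _ d * y)) n (C a * F + C b * G) (C c * F + C d * G) := by
  have hC : ∀ (c : k) {H : MvPolynomial (Fin 3) k} {n : ℕ}, H.IsHomogeneous n →
      (C c * H).IsHomogeneous n := fun c H n hH => by
    simpa using (isHomogeneous_C (Fin 3) c).mul hH
  refine ⟨(hC a h.1).add (hC b h.2.1), (hC c h.1).add (hC d h.2.1), ?_⟩
  simp only [map_add, map_mul, aeval_C, ← h.2.2]
  rw [div_mul_eq_mul_div, div_eq_iff h0]
  field_simp

/-- There is a rational function of degree two with prescribed values at four points. -/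
def Interpolates (P₁ P₂ P₃ P₄ : E.Point) (a b c d : ℙ k (Fin 2 → k)) : Prop :=
  ∃ f : E.FunctionField, f ≠ 0 ∧ degree f = 2 ∧
    HasValueAt f P₁ a ∧ HasValueAt f P₂ b ∧ HasValueAt f P₃ c ∧ HasValueAt f P₄ d

/-- The projection `g` from `R` is normalised by `g(γ) = 0` and `g(δ) = ∞`, and `hrel` says `g(α) =
l g(β)`. The Möbius map sending `0, ∞, g(β)` to `c, d, b` then sends `g(α)` to `a`. The values at
`α` and `β` are given by arbitrary representations, so that `R` may coincide with `α`. -/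
theorem interpolates_of_cross_ratio [IsAlgClosed k] [E.IsElliptic] {α β γ δ R : E.Point}
    (hαβ : α ≠ β) (hαγ : α ≠ γ) (hαδ : α ≠ δ) (hβγ : β ≠ γ) (hβδ : β ≠ δ)
    (hD : det₃ δ γ R ≠ 0) {a b c d : Fin 2 → k} (ha : a ≠ 0) (hb : b ≠ 0) (hc : c ≠ 0) (hd : d ≠ 0)
    (hac : det₂ a c ≠ 0) (hbc : det₂ b c ≠ 0) (hdb : det₂ d b ≠ 0) (hdc : det₂ d c ≠ 0) {l : k} (hl0 : l ≠ 0)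
    (hl : l * (det₂ d a * det₂ b c) = det₂ a c * det₂ d b)
    {n₁ n₂ : ℕ} {F₁ G₁ F₂ G₂ : MvPolynomial (Fin 3) k}
    (hq₁ : IsQuotient (lin E (homCoords γ ⨯₃ homCoords R) / lin E (homCoords R ⨯₃ homCoords δ))
      n₁ F₁ G₁)
    (h₁ : eval (homCoords α) F₁ ≠ 0 ∨ eval (homCoords α) G₁ ≠ 0)
    (hq₂ : IsQuotient (lin E (homCoords γ ⨯₃ homCoords R) / lin E (homCoords R ⨯₃ homCoords δ))
      n₂ F₂ G₂)
    (h₂ : eval (homCoords β) F₂ ≠ 0 ∨ eval (homCoords β) G₂ ≠ 0)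
    (hrel : eval (homCoords α) F₁ * eval (homCoords β) G₂ =
      l * (eval (homCoords α) G₁ * eval (homCoords β) F₂)) :
    Interpolates α β γ δ (Projectivization.mk k a ha) (Projectivization.mk k b hb)
      (Projectivization.mk k c hc) (Projectivization.mk k d hd) := by
  obtain ⟨hξ, hη⟩ := cross_ne_zero_of_frame hD
  have hy0 : lin E (homCoords R ⨯₃ homCoords δ) ≠ 0 := lin_ne_zero hη
  have hx0 : lin E (homCoords γ ⨯₃ homCoords R) ≠ 0 := lin_ne_zero hξ
  have hq : IsQuotient _ 1 _ _ := isQuotient_div (E := E)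
    (linForm_isHomogeneous (homCoords γ ⨯₃ homCoords R))
    (linForm_isHomogeneous (homCoords R ⨯₃ homCoords δ)) hy0
  simp only [aeval_linForm] at hq
  have hxγ : eval (homCoords γ) (linForm (homCoords γ ⨯₃ homCoords R)) = 0 := by
    rw [eval_linForm, cross_dot_homCoords, det₃_self_outer]
  have hyγ : eval (homCoords γ) (linForm (homCoords R ⨯₃ homCoords δ)) = det₃ δ γ R := by
    rw [eval_linForm, cross_dot_homCoords, det₃_swap_left, det₃_swap_right, neg_neg]
  have hxδ : eval (homCoords δ) (linForm (homCoords γ ⨯₃ homCoords R)) = det₃ δ γ R := by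
    rw [eval_linForm, cross_dot_homCoords, det₃_swap_right, det₃_swap_left, neg_neg]
  have hyδ : eval (homCoords δ) (linForm (homCoords R ⨯₃ homCoords δ)) = 0 := by
    rw [eval_linForm, cross_dot_homCoords, det₃_self_right]
  -- By `hrel`, if `g` is `0` at one of `α`, `β` it is `0` at the other, and likewise for `∞`. With
  -- `γ`, respectively `δ`, this would make three zeros or three poles.
  have hzero : ¬(eval (homCoords α) F₁ = 0 ∧ eval (homCoords β) F₂ = 0) := by
    rintro ⟨h1, h2⟩
    refine not_three_zeros_of_frame hD (S := ![α, β, γ]) ?_ fun j => ?_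
    · intro j j' h
      fin_cases j <;> fin_cases j' <;> simp_all
    · fin_cases j
      · exact ⟨_, _, _, hq₁, h1, h₁.resolve_left (not_not.mpr h1)⟩
      · exact ⟨_, _, _, hq₂, h2, h₂.resolve_left (not_not.mpr h2)⟩
      · exact ⟨_, _, _, hq, hxγ, hyγ.trans_ne hD⟩
  have hpole : ¬(eval (homCoords α) G₁ = 0 ∧ eval (homCoords β) G₂ = 0) := by
    rintro ⟨h1, h2⟩
    have hD' : homCoords γ ⬝ᵥ homCoords δ ⨯₃ homCoords R ≠ 0 := by
      have := det₃_swap_left δ γ R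
      rw [det₃] at this
      rw [this, neg_ne_zero]
      exact hD
    -- The inverse of `g` is the projection from `R` with `γ` and `δ` exchanged, so poles are
    -- counted as zeros.
    have hinv : ∀ {n F G}, IsQuotient
        (lin E (homCoords γ ⨯₃ homCoords R) / lin E (homCoords R ⨯₃ homCoords δ)) n F G →
        IsQuotient (lin E (homCoords δ ⨯₃ homCoords R) / lin E (homCoords R ⨯₃ homCoords γ))
          n G F := by
      intro n F G h
      refine ⟨h.2.1, h.1, ?_⟩
      rw [← h.2.2, ← cross_anticomm, ← cross_anticomm (homCoords γ), lin_neg, lin_neg]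
      field_simp
    refine not_three_zeros_of_frame hD' (S := ![α, β, δ]) ?_ fun j => ?_
    · intro j j' h
      fin_cases j <;> fin_cases j' <;> simp_all
    · fin_cases j
      · exact ⟨_, _, _, hinv hq₁, h1, h₁.resolve_right (not_not.mpr h1)⟩
      · exact ⟨_, _, _, hinv hq₂, h2, h₂.resolve_right (not_not.mpr h2)⟩
      · exact ⟨_, _, _, hinv hq, hyδ, hxδ.trans_ne hD⟩
  have hF₁ : eval (homCoords α) F₁ ≠ 0 := by
    intro h
    have hG := h₁.resolve_left (not_not.mpr h)
    rw [h, zero_mul, eq_comm] at hrel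
    exact hzero ⟨h, by simpa [hl0, hG] using hrel⟩
  have hG₁ : eval (homCoords α) G₁ ≠ 0 := by
    intro h
    rw [h, zero_mul, mul_zero] at hrel
    exact hpole ⟨h, by simpa [hF₁] using hrel⟩
  have hF₂ : eval (homCoords β) F₂ ≠ 0 := by
    intro h
    have hG := h₂.resolve_left (not_not.mpr h)
    rw [h, mul_zero, mul_zero] at hrel
    exact mul_ne_zero hF₁ hG hrel
  have hG₂ : eval (homCoords β) G₂ ≠ 0 := by
    intro h
    rw [h, mul_zero, eq_comm] at hrel
    exact mul_ne_zero hl0 (mul_ne_zero hG₁ hF₂) hrel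
  -- With these weights the vector `s F₂(β) d + t G₂(β) c` is `det(b, c) d + det(d, b) c = det(d, c)
  -- b`, by the Plücker identity.
  obtain ⟨s, hs⟩ : ∃ s, s = det₂ b c / eval (homCoords β) F₂ := ⟨_, rfl⟩
  obtain ⟨t, ht⟩ : ∃ t, t = det₂ d b / eval (homCoords β) G₂ := ⟨_, rfl⟩
  have hs0 : s ≠ 0 := hs ▸ div_ne_zero hbc hF₂
  have ht0 : t ≠ 0 := ht ▸ div_ne_zero hdb hG₂
  have hst : t * eval (homCoords α) G₁ * det₂ a c = s * eval (homCoords α) F₁ * det₂ d a := by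
    rw [hs, ht]
    field_simp
    linear_combination (-eval (homCoords α) G₁ * eval (homCoords β) F₂) * hl -
      det₂ d a * det₂ b c * hrel
  -- The composite `(s d₀ g + t c₀) / (s d₁ g + t c₁)` is again a projection from `R`, for a new
  -- frame, so its degree is already known.
  have hD' : ((t * c 1) • homCoords δ - (s * d 1) • homCoords γ) ⬝ᵥ
      ((s * d 0) • homCoords γ - (t * c 0) • homCoords δ) ⨯₃ homCoords R ≠ 0 := by
    have : ((t * c 1) • homCoords δ - (s * d 1) • homCoords γ) ⬝ᵥ
        ((s * d 0) • homCoords γ - (t * c 0) • homCoords δ) ⨯₃ homCoords R =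
        s * t * det₂ d c * det₃ δ γ R := by
      simp [det₃, det₂, cross_apply, dotProduct, Fin.sum_univ_three]; ring
    rw [this]
    exact mul_ne_zero (mul_ne_zero (mul_ne_zero hs0 ht0) hdc) hD
  obtain ⟨hξ', hη'⟩ := cross_ne_zero_of_frame hD'
  have ex : lin E (((s * d 0) • homCoords γ - (t * c 0) • homCoords δ) ⨯₃ homCoords R) =
      algebraMap k _ (s * d 0) * lin E (homCoords γ ⨯₃ homCoords R) +
        algebraMap k _ (t * c 0) * lin E (homCoords R ⨯₃ homCoords δ) := by
    rw [← lin_smul, ← lin_smul, ← lin_add]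
    congr 1
    rw [← cross_anticomm (homCoords δ)]
    simp only [map_sub, map_smul, LinearMap.sub_apply, LinearMap.smul_apply]
    module
  have ey : lin E (homCoords R ⨯₃ ((t * c 1) • homCoords δ - (s * d 1) • homCoords γ)) =
      algebraMap k _ (s * d 1) * lin E (homCoords γ ⨯₃ homCoords R) +
        algebraMap k _ (t * c 1) * lin E (homCoords R ⨯₃ homCoords δ) := by
    rw [← lin_smul, ← lin_smul, ← lin_add]
    congr 1
    rw [← cross_anticomm (homCoords R) (homCoords γ)]
    simp only [map_sub, map_smul]
    module
  have hM : ∀ {n F G}, IsQuotient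
      (lin E (homCoords γ ⨯₃ homCoords R) / lin E (homCoords R ⨯₃ homCoords δ)) n F G →
      IsQuotient (lin E (((s * d 0) • homCoords γ - (t * c 0) • homCoords δ) ⨯₃ homCoords R) /
        lin E (homCoords R ⨯₃ ((t * c 1) • homCoords δ - (s * d 1) • homCoords γ))) n
        (C (s * d 0) * F + C (t * c 0) * G) (C (s * d 1) * F + C (t * c 1) * G) := by
    intro n F G h
    rw [ex, ey]
    exact h.moebius hy0 _ _ _ _ (ey ▸ lin_ne_zero hη')
  refine ⟨_, div_ne_zero (lin_ne_zero hξ') (lin_ne_zero hη'), degree_eq_two_of_frame hD',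
    hasValueAt_mk (hM hq₁) ha (μ := s * eval (homCoords α) F₁ * det₂ d c / det₂ a c) ?_ ?_ ?_,
    hasValueAt_mk (hM hq₂) hb (μ := det₂ d c) hdc ?_ ?_,
    hasValueAt_mk (hM hq) hc (μ := t * det₃ δ γ R) (mul_ne_zero ht0 hD) ?_ ?_,
    hasValueAt_mk (hM hq) hd (μ := s * det₃ δ γ R) (mul_ne_zero hs0 hD) ?_ ?_⟩
  · exact div_ne_zero (mul_ne_zero (mul_ne_zero hs0 hF₁) hdc) hac
  · simp only [map_add, map_mul, eval_C]
    rw [div_mul_eq_mul_div, eq_div_iff hac]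
    simp only [det₂] at hst ⊢
    linear_combination c 0 * hst
  · simp only [map_add, map_mul, eval_C]
    rw [div_mul_eq_mul_div, eq_div_iff hac]
    simp only [det₂] at hst ⊢
    linear_combination c 1 * hst
  · simp only [map_add, map_mul, eval_C, hs, ht, det₂]
    field_simp
    ring
  · simp only [map_add, map_mul, eval_C, hs, ht, det₂]
    field_simp
    ring
  · simp only [map_add, map_mul, eval_C, hxγ, hyγ]; ring
  · simp only [map_add, map_mul, eval_C, hxγ, hyγ]; ring
  · simp only [map_add, map_mul, eval_C, hxδ, hyδ]; ring
  · simp only [map_add, map_mul, eval_C, hxδ, hyδ]; ring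

end Moebius

/-! ### The cross ratio of four lines as a function of the centre -/

section CrossRatio

variable {k : Type*} [Field k] {E : WeierstrassCurve.Affine k}

theorem det₃_ne_zero_of_eq_zero [IsAlgClosed k] [E.IsElliptic] {P Q S T : E.Point} (hPQ : P ≠ Q)
    (hPS : P ≠ S) (hPT : P ≠ T) (hQS : Q ≠ S) (hQT : Q ≠ T) (hST : S ≠ T) (h : det₃ P Q S = 0) :
    det₃ P Q T ≠ 0 := by
  intro h'
  refine not_collinear (R := Q) (S₁ := P) (S₂ := S) (S₃ := T) hPQ hQS.symm hQT.symm hPS hPT hST ?_ ?_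
  · rw [det₃_swap_left, det₃_swap_right, h, neg_neg]
  · rw [det₃_swap_left, det₃_swap_right, h', neg_neg]

/-- The relation holds on the whole plane. Sums of two of the coordinate vectors kill one side, and
of the four determinants that occur at most one vanishes, as no four points are collinear. -/
theorem cross_products_independent [IsAlgClosed k] [E.IsElliptic] {α β γ δ : E.Point}
    (hαβ : α ≠ β) (hαγ : α ≠ γ) (hαδ : α ≠ δ) (hβγ : β ≠ γ) (hβδ : β ≠ δ) (hγδ : γ ≠ δ)
    {c c' : k} (h : algebraMap k _ c * (lin E (homCoords α ⨯₃ homCoords γ) *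
        lin E (homCoords β ⨯₃ homCoords δ)) =
      algebraMap k _ c' * (lin E (homCoords α ⨯₃ homCoords δ) *
        lin E (homCoords β ⨯₃ homCoords γ))) : c = 0 ∧ c' = 0 := by
  have key := lin_mul_lin_eq E h
  have e1 := key (homCoords α + homCoords γ)
  have e2 := key (homCoords β + homCoords δ)
  have e3 := key (homCoords α + homCoords δ)
  have e4 := key (homCoords β + homCoords γ)
  simp only [dotProduct_add, cross_dot_homCoords, det₃_self_outer, det₃_self_right, add_zero,
    zero_add, zero_mul, mul_zero] at e1 e2 e3 e4
  have p1 : det₃ α δ γ = -det₃ α γ δ := det₃_swap_right _ _ _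
  have p2 : det₃ β γ α = det₃ α β γ := by rw [det₃_swap_right, det₃_swap_left, neg_neg]
  have p3 : det₃ α δ β = -det₃ α β δ := det₃_swap_right _ _ _
  have p4 : det₃ β δ α = det₃ α β δ := by rw [det₃_swap_right, det₃_swap_left, neg_neg]
  have p5 : det₃ α γ β = -det₃ α β γ := det₃_swap_right _ _ _
  have p6 : det₃ β δ γ = -det₃ β γ δ := det₃_swap_right _ _ _
  rw [p1, p2] at e1
  rw [p3] at e2
  rw [p4] at e3
  rw [p5, p6] at e4
  have h12 : det₃ α β γ = 0 → det₃ α β δ ≠ 0 :=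
    det₃_ne_zero_of_eq_zero hαβ hαγ hαδ hβγ hβδ hγδ
  have h13 : det₃ α β γ = 0 → det₃ α γ δ ≠ 0 := fun h =>
    det₃_ne_zero_of_eq_zero hαγ hαβ hαδ hβγ.symm hγδ hβδ (by rw [p5, h, neg_zero])
  have h14 : det₃ α β γ = 0 → det₃ β γ δ ≠ 0 := fun h =>
    det₃_ne_zero_of_eq_zero hβγ hαβ.symm hβδ hαγ.symm hγδ hαδ (by rw [p2, h])
  have h23 : det₃ α β δ = 0 → det₃ α γ δ ≠ 0 := fun h h' =>
    det₃_ne_zero_of_eq_zero hαδ hαβ hαγ hβδ.symm hγδ.symm hβγ (by rw [p3, h, neg_zero])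
      (by rw [p1, h', neg_zero])
  have h24 : det₃ α β δ = 0 → det₃ β γ δ ≠ 0 := fun h h' =>
    det₃_ne_zero_of_eq_zero hβδ hαβ.symm hβγ hαδ.symm hγδ.symm hαγ (by rw [p4, h])
      (by rw [p6, h', neg_zero])
  have h34 : det₃ α γ δ = 0 → det₃ β γ δ ≠ 0 := fun h h' =>
    det₃_ne_zero_of_eq_zero hγδ hαγ.symm hβγ.symm hαδ.symm hβδ.symm hαβ
      (by rw [det₃_swap_right, det₃_swap_left, h, neg_neg])
      (by rw [det₃_swap_right, det₃_swap_left, h', neg_neg])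
  constructor
  · by_contra hc
    have e3' : c * (det₃ α γ δ * det₃ α β δ) = 0 := by linear_combination e3
    have e4' : c * (det₃ α β γ * det₃ β γ δ) = 0 := by linear_combination e4
    rcases mul_eq_zero.mp ((mul_eq_zero.mp e3').resolve_left hc) with h | h <;>
      rcases mul_eq_zero.mp ((mul_eq_zero.mp e4').resolve_left hc) with h' | h'
    exacts [h13 h' h, h34 h h', h12 h' h, h24 h h']
  · by_contra hc
    have e1' : c' * (det₃ α γ δ * det₃ α β γ) = 0 := by linear_combination e1
    have e2' : c' * (det₃ α β δ * det₃ β γ δ) = 0 := by linear_combination e2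
    rcases mul_eq_zero.mp ((mul_eq_zero.mp e1').resolve_left hc) with h | h <;>
      rcases mul_eq_zero.mp ((mul_eq_zero.mp e2').resolve_left hc) with h' | h'
    exacts [h23 h' h, h34 h h', h12 h h', h14 h h']

variable (l : k) (α β γ δ : E.Point)

/-- The numerator of the cross ratio, minus `l` times its denominator, at the generic point. -/
def crossDiff : E.FunctionField :=
  lin E (homCoords α ⨯₃ homCoords γ) * lin E (homCoords β ⨯₃ homCoords δ) -
    algebraMap k _ l *
      (lin E (homCoords α ⨯₃ homCoords δ) * lin E (homCoords β ⨯₃ homCoords γ))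

/-- The rational function `1 / (h - l)`, where `h(R)` is the cross ratio of the lines joining `R`
to four given points. -/
def crossQuot : E.FunctionField :=
  lin E (homCoords α ⨯₃ homCoords δ) * lin E (homCoords β ⨯₃ homCoords γ) / crossDiff l α β γ δ

theorem lin_cross_swap (P Q : E.Point) :
    lin E (homCoords Q ⨯₃ homCoords P) = -lin E (homCoords P ⨯₃ homCoords Q) := by
  rw [← cross_anticomm, lin_neg]

/-- This symmetry and the next one generate the Klein four-group fixing the cross ratio. It acts
transitively on the four points, so a pole at any of them can be moved to the first position. -/
theorem crossQuot_swap : crossQuot l β α δ γ = crossQuot l α β γ δ := by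
  have h : crossDiff l β α δ γ = crossDiff l α β γ δ := by simp only [crossDiff]; ring
  rw [crossQuot, crossQuot, h, mul_comm]

theorem crossQuot_swap' : crossQuot l γ δ α β = crossQuot l α β γ δ := by
  have h : crossDiff l γ δ α β = crossDiff l α β γ δ := by
    simp only [crossDiff, lin_cross_swap α γ, lin_cross_swap α δ, lin_cross_swap β γ,
      lin_cross_swap β δ]
    ring
  rw [crossQuot, crossQuot, h, lin_cross_swap β γ, lin_cross_swap α δ]
  ring

variable {l α β γ δ}

theorem crossDiff_ne_zero [IsAlgClosed k] [E.IsElliptic]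
    (hαβ : α ≠ β) (hαγ : α ≠ γ) (hαδ : α ≠ δ) (hβγ : β ≠ γ) (hβδ : β ≠ δ) (hγδ : γ ≠ δ) :
    crossDiff l α β γ δ ≠ 0 := fun h =>
  one_ne_zero (cross_products_independent (c := 1) (c' := l) hαβ hαγ hαδ hβγ hβδ hγδ (by
    rw [map_one, one_mul]
    exact sub_eq_zero.mp h)).1

theorem exists_crossQuot_notMem_localRing [IsAlgClosed k] [E.IsElliptic]
    (hαβ : α ≠ β) (hαγ : α ≠ γ) (hαδ : α ≠ δ) (hβγ : β ≠ γ) (hβδ : β ≠ δ) (hγδ : γ ≠ δ) :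
    ∃ P : E.Point, crossQuot l α β γ δ ∉ localRing P := by
  by_contra hcon
  push Not at hcon
  obtain ⟨c, hc⟩ := exists_eq_algebraMap_of_forall_mem_localRing hcon
  rw [crossQuot, div_eq_iff (crossDiff_ne_zero hαβ hαγ hαδ hβγ hβδ hγδ), crossDiff] at hc
  obtain ⟨rfl, h⟩ := cross_products_independent (c := c) (c' := 1 + c * l)
    hαβ hαγ hαδ hβγ hβδ hγδ (by
      simp only [map_add, map_mul, map_one]
      linear_combination -hc)
  simp at h

/-- Either the denominator of `1 / (h - l)` is nonzero at `R`, or its vanishing is exactly the cross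
ratio condition for projecting from `R`. -/
theorem interpolates_or_crossQuot_mem_of_ne [IsAlgClosed k] [E.IsElliptic]
    (hαβ : α ≠ β) (hαγ : α ≠ γ) (hαδ : α ≠ δ) (hβγ : β ≠ γ) (hβδ : β ≠ δ) (hγδ : γ ≠ δ)
    {a b c d : Fin 2 → k} (ha : a ≠ 0) (hb : b ≠ 0) (hc : c ≠ 0) (hd : d ≠ 0)
    (hac : det₂ a c ≠ 0) (hbc : det₂ b c ≠ 0) (hdb : det₂ d b ≠ 0) (hdc : det₂ d c ≠ 0)
    (hl0 : l ≠ 0) (hl1 : l ≠ 1) (hl : l * (det₂ d a * det₂ b c) = det₂ a c * det₂ d b)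
    {R : E.Point} (hRα : R ≠ α) (hRβ : R ≠ β) (hRγ : R ≠ γ) (hRδ : R ≠ δ) :
    Interpolates α β γ δ (Projectivization.mk k a ha) (Projectivization.mk k b hb)
        (Projectivization.mk k c hc) (Projectivization.mk k d hd) ∨
      crossQuot l α β γ δ ∈ localRing R := by
  have hF : (linForm (homCoords α ⨯₃ homCoords δ) *
      linForm (homCoords β ⨯₃ homCoords γ)).IsHomogeneous 2 :=
    (linForm_isHomogeneous _).mul (linForm_isHomogeneous _)
  have hG : (linForm (homCoords α ⨯₃ homCoords γ) * linForm (homCoords β ⨯₃ homCoords δ) -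
      C l * (linForm (homCoords α ⨯₃ homCoords δ) *
        linForm (homCoords β ⨯₃ homCoords γ))).IsHomogeneous 2 := by
    refine ((linForm_isHomogeneous _).mul (linForm_isHomogeneous _)).sub ?_
    simpa using (isHomogeneous_C (Fin 3) l).mul hF
  by_cases h0 : det₃ α γ R * det₃ β δ R - l * (det₃ α δ R * det₃ β γ R) = 0
  swap
  · right
    have := div_mem_localRing (P := R) hF hG (by
      simpa only [map_sub, map_mul, eval_C, eval_linForm, cross_dot_homCoords] using h0)
    simpa only [map_sub, map_mul, aeval_C, aeval_linForm, crossQuot, crossDiff] using this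
  left
  -- If `R`, `γ`, `δ` were collinear, the lines `Rγ` and `Rδ` would coincide and the cross ratio
  -- would be `1`.
  have hD : det₃ δ γ R ≠ 0 := by
    intro hD
    obtain ⟨m, n, hmn⟩ := exists_smul_add_smul_of_det₃_eq_zero (P := R) (Q := δ) (S := γ) hRδ (by
      rw [det₃_swap_left, det₃_swap_right, hD, neg_neg])
    have hlin : ∀ P : E.Point, det₃ P γ R = n * det₃ P δ R := fun P => by
      rw [det₃, hmn]
      simp [det₃, cross_apply, dotProduct, Fin.sum_univ_three]; ring
    have hn : n ≠ 0 := by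
      rintro rfl
      apply hRγ
      apply eq_of_cross_eq_zero
      rw [hmn]
      simp
    have h1 : det₃ α δ R ≠ 0 := fun h => not_collinear hRδ.symm hRγ.symm hRα.symm hγδ.symm hαδ.symm
      hαγ.symm (by rw [det₃_swap_left, hD, neg_zero]) h
    have h2 : det₃ β δ R ≠ 0 := fun h => not_collinear hRδ.symm hRγ.symm hRβ.symm hγδ.symm hβδ.symm
      hβγ.symm (by rw [det₃_swap_left, hD, neg_zero]) h
    rw [hlin α, hlin β] at h0
    have : n * (det₃ α δ R * det₃ β δ R) * (1 - l) = 0 := by linear_combination h0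
    exact mul_ne_zero (mul_ne_zero hn (mul_ne_zero h1 h2)) (sub_ne_zero.mpr hl1.symm) this
  have hy0 := lin_ne_zero (E := E) (cross_ne_zero_of_frame hD).2
  have hq : IsQuotient _ 1 _ _ := isQuotient_div (E := E)
    (linForm_isHomogeneous (homCoords γ ⨯₃ homCoords R))
    (linForm_isHomogeneous (homCoords R ⨯₃ homCoords δ)) hy0
  have hne : ∀ P : E.Point, R ≠ P →
      eval (homCoords P) (linForm (homCoords γ ⨯₃ homCoords R)) ≠ 0 ∨
      eval (homCoords P) (linForm (homCoords R ⨯₃ homCoords δ)) ≠ 0 := by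
    intro P hP
    by_contra hcon
    push Not at hcon
    rw [eval_linForm, eval_linForm] at hcon
    exact hP (eq_of_frame_dot_eq_zero hD hcon.1 hcon.2).symm
  refine interpolates_of_cross_ratio hαβ hαγ hαδ hβγ hβδ hD ha hb hc hd hac hbc hdb hdc hl0 hl hq
    (hne α hRα) hq (hne β hRβ) ?_
  simp only [eval_linForm, cross_dot_homCoords]
  have r : ∀ P : E.Point, det₃ R δ P = -det₃ P δ R := fun P => by
    rw [det₃_rotate P R δ, det₃_swap_right P δ R]
  rw [det₃_rotate α γ R, det₃_rotate β γ R, r, r]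
  linear_combination -h0

/-- At `R = α` numerator and denominator of `1 / (h - l)` both vanish. Dividing both by the line
`αδ` turns `αγ / αδ` into minus the projection from `α`, whose value at `α` itself is given by the
tangent. -/
theorem interpolates_or_crossQuot_mem_left [IsAlgClosed k] [E.IsElliptic]
    (hαβ : α ≠ β) (hαγ : α ≠ γ) (hαδ : α ≠ δ) (hβγ : β ≠ γ) (hβδ : β ≠ δ) (hγδ : γ ≠ δ)
    {a b c d : Fin 2 → k} (ha : a ≠ 0) (hb : b ≠ 0) (hc : c ≠ 0) (hd : d ≠ 0)
    (hac : det₂ a c ≠ 0) (hbc : det₂ b c ≠ 0) (hdb : det₂ d b ≠ 0) (hdc : det₂ d c ≠ 0)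
    (hl0 : l ≠ 0) (hl1 : l ≠ 1) (hl : l * (det₂ d a * det₂ b c) = det₂ a c * det₂ d b) :
    Interpolates α β γ δ (Projectivization.mk k a ha) (Projectivization.mk k b hb)
        (Projectivization.mk k c hc) (Projectivization.mk k d hd) ∨
      crossQuot l α β γ δ ∈ localRing α := by
  have hden := crossDiff_ne_zero (l := l) hαβ hαγ hαδ hβγ hβδ hγδ
  have hlC : ∀ {H : MvPolynomial (Fin 3) k} {n : ℕ}, H.IsHomogeneous n →
      (C l * H).IsHomogeneous n := fun {H n} hH => by
    simpa using (isHomogeneous_C (Fin 3) l).mul hH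
  have hy0 : lin E (homCoords α ⨯₃ homCoords δ) ≠ 0 := lin_ne_zero (cross_homCoords_ne_zero hαδ)
  by_cases hD : det₃ δ γ α = 0
  -- Here `αγ` and `αδ` are the same line and cancel. The value of `1 / (h - l)` at `α` is then `1 /
  -- (1 - l)`, which is finite.
  · right
    obtain ⟨m, n, hmn⟩ := exists_smul_add_smul_of_det₃_eq_zero (P := α) (Q := δ) (S := γ) hαδ (by
      rw [det₃_swap_left, det₃_swap_right, hD, neg_neg])
    have hn : n ≠ 0 := by
      rintro rfl
      apply hαγ
      apply eq_of_cross_eq_zero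
      rw [hmn]
      simp
    have hcross : homCoords α ⨯₃ homCoords γ = n • homCoords α ⨯₃ homCoords δ := by
      rw [hmn]
      simp
    have hβ : det₃ β γ α = n * det₃ β δ α := by
      rw [det₃, hmn]
      simp [det₃, cross_apply, dotProduct, Fin.sum_univ_three]; ring
    have hβ0 : det₃ β δ α ≠ 0 := fun h => not_collinear hαδ.symm hαγ.symm hαβ.symm hγδ.symm
      hβδ.symm hβγ.symm (by rw [det₃_swap_left, hD, neg_zero]) h
    have := div_mem_localRing (E := E) (P := α) (linForm_isHomogeneous (homCoords β ⨯₃ homCoords γ))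
      ((linForm_isHomogeneous (n • homCoords β ⨯₃ homCoords δ)).sub
        (hlC (linForm_isHomogeneous (homCoords β ⨯₃ homCoords γ)))) (by
        rw [map_sub, map_mul, eval_C, eval_linForm, eval_linForm, smul_dotProduct,
          cross_dot_homCoords, cross_dot_homCoords, hβ, smul_eq_mul]
        have : n * det₃ β δ α - l * (n * det₃ β δ α) = n * det₃ β δ α * (1 - l) := by ring
        rw [this]
        exact mul_ne_zero (mul_ne_zero hn hβ0) (sub_ne_zero.mpr hl1.symm))
    convert this using 1
    simp only [map_sub, map_mul, aeval_C, aeval_linForm]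
    have e : crossDiff l α β γ δ = lin E (homCoords α ⨯₃ homCoords δ) *
        (lin E (n • homCoords β ⨯₃ homCoords δ) -
          algebraMap k _ l * lin E (homCoords β ⨯₃ homCoords γ)) := by
      rw [crossDiff, hcross, lin_smul, lin_smul]
      ring
    rw [crossQuot, e, mul_div_mul_left _ _ hy0]
  obtain ⟨n, F, G, hq, hFG⟩ := exists_isQuotient_of_frame hD α
  have hx : lin E (homCoords γ ⨯₃ homCoords α) = -lin E (homCoords α ⨯₃ homCoords γ) :=
    lin_cross_swap _ _
  have hF' : (G * linForm (homCoords β ⨯₃ homCoords γ)).IsHomogeneous (n + 1) :=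
    hq.2.1.mul (linForm_isHomogeneous _)
  have hG' : (-(F * linForm (homCoords β ⨯₃ homCoords δ)) -
      C l * (G * linForm (homCoords β ⨯₃ homCoords γ))).IsHomogeneous (n + 1) :=
    (hq.1.mul (linForm_isHomogeneous _)).neg.sub (hlC hF')
  by_cases h0 : -(eval (homCoords α) F * det₃ β δ α) - l * (eval (homCoords α) G * det₃ β γ α) = 0
  swap
  · right
    refine ⟨n + 1, _, _, ⟨hF', hG', ?_⟩, by
      simpa only [map_sub, map_mul, map_neg, eval_C, eval_linForm, cross_dot_homCoords] using h0⟩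
    simp only [map_sub, map_mul, map_neg, aeval_C, aeval_linForm]
    rw [crossQuot, div_mul_eq_mul_div, div_eq_iff hden, ← hq.2.2, hx, crossDiff]
    field_simp
  left
  have hq' : IsQuotient _ 1 _ _ := isQuotient_div (E := E)
    (linForm_isHomogeneous (homCoords γ ⨯₃ homCoords α))
    (linForm_isHomogeneous (homCoords α ⨯₃ homCoords δ)) hy0
  refine interpolates_of_cross_ratio hαβ hαγ hαδ hβγ hβδ hD ha hb hc hd hac hbc hdb hdc hl0 hl hq
    hFG hq' ?_ ?_
  · by_contra hcon
    push Not at hcon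
    rw [eval_linForm, eval_linForm] at hcon
    exact hαβ (eq_of_frame_dot_eq_zero hD hcon.1 hcon.2).symm
  · simp only [eval_linForm, cross_dot_homCoords]
    rw [det₃_rotate β γ α, det₃_rotate β α δ, det₃_swap_right β δ α]
    linear_combination h0

end CrossRatio

end

end EllipticFunction

/-! ### Conclusion: projecting from a pole of `1 / (h - l)` -/

theorem mainTheorem6 {k : Type*} [Field k] [IsAlgClosed k] [CharZero k]
    (E : WeierstrassCurve.Affine k) [E.IsElliptic]
    (α β γ δ : E.Point)
    (hαβ : α ≠ β) (hαγ : α ≠ γ) (hαδ : α ≠ δ) (hβγ : β ≠ γ) (hβδ : β ≠ δ) (hγδ : γ ≠ δ)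
    (a b c d : ℙ k (Fin 2 → k))
    (hab : a ≠ b) (hac : a ≠ c) (had : a ≠ d) (hbc : b ≠ c) (hbd : b ≠ d) (hcd : c ≠ d) :
    ∃ f : E.FunctionField, f ≠ 0 ∧ EllipticFunction.degree f = 2 ∧
      EllipticFunction.HasValueAt f α a ∧ EllipticFunction.HasValueAt f β b ∧
      EllipticFunction.HasValueAt f γ c ∧ EllipticFunction.HasValueAt f δ d := by
  open EllipticFunction in
  induction a using Projectivization.ind with | h a ha => ?_
  induction b using Projectivization.ind with | h b hb => ?_
  induction c using Projectivization.ind with | h c hc => ?_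
  induction d using Projectivization.ind with | h d hd => ?_
  have nab := det₂_ne_zero ha hb hab
  have nac := det₂_ne_zero ha hc hac
  have nad := det₂_ne_zero ha hd had
  have nbc := det₂_ne_zero hb hc hbc
  have nbd := det₂_ne_zero hb hd hbd
  have ncd := det₂_ne_zero hc hd hcd
  have nba := det₂_ne_zero hb ha hab.symm
  have nca := det₂_ne_zero hc ha hac.symm
  have nda := det₂_ne_zero hd ha had.symm
  have ncb := det₂_ne_zero hc hb hbc.symm
  have ndb := det₂_ne_zero hd hb hbd.symm
  have ndc := det₂_ne_zero hd hc hcd.symm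
  -- The cross ratio of the target points; it differs from `1` by the Plücker relation, since
  -- `det(a, b) det(c, d) ≠ 0`.
  obtain ⟨l, hl⟩ : ∃ l : k, l * (det₂ d a * det₂ b c) = det₂ a c * det₂ d b :=
    ⟨_, div_mul_cancel₀ _ (mul_ne_zero nda nbc)⟩
  have hl0 : l ≠ 0 := by
    rintro rfl
    rw [zero_mul] at hl
    exact mul_ne_zero nac ndb hl.symm
  have hl1 : l ≠ 1 := by
    rintro rfl
    apply mul_ne_zero nab ncd
    simp only [det₂] at hl ⊢
    linear_combination hl
  obtain ⟨P, hP⟩ := exists_crossQuot_notMem_localRing (l := l) hαβ hαγ hαδ hβγ hβδ hγδ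
  by_cases hα : P = α
  · subst hα
    exact (interpolates_or_crossQuot_mem_left hαβ hαγ hαδ hβγ hβδ hγδ ha hb hc hd nac nbc ndb ndc
      hl0 hl1 hl).resolve_right hP
  by_cases hβ : P = β
  · subst hβ
    rw [← crossQuot_swap] at hP
    obtain ⟨f, h, h', h1, h2, h3, h4⟩ := (interpolates_or_crossQuot_mem_left hαβ.symm hβδ hβγ hαδ
      hαγ hγδ.symm hb ha hd hc nbd nad nca ncd hl0 hl1
      (by simp only [det₂] at hl ⊢; linear_combination hl)).resolve_right hP
    exact ⟨f, h, h', h2, h1, h4, h3⟩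
  by_cases hγ : P = γ
  · subst hγ
    rw [← crossQuot_swap'] at hP
    obtain ⟨f, h, h', h1, h2, h3, h4⟩ := (interpolates_or_crossQuot_mem_left hγδ hαγ.symm hβγ.symm
      hαδ.symm hβδ.symm hαβ hc hd ha hb nca nda nbd nba hl0 hl1
      (by simp only [det₂] at hl ⊢; linear_combination hl)).resolve_right hP
    exact ⟨f, h, h', h3, h4, h1, h2⟩
  by_cases hδ : P = δ
  · subst hδ
    rw [← crossQuot_swap', ← crossQuot_swap] at hP
    obtain ⟨f, h, h', h1, h2, h3, h4⟩ := (interpolates_or_crossQuot_mem_left hγδ.symm hβδ.symm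
      hαδ.symm hβγ.symm hαγ.symm hαβ.symm hd hc hb ha ndb ncb nac nab hl0 hl1
      (by simp only [det₂] at hl ⊢; linear_combination hl)).resolve_right hP
    exact ⟨f, h, h', h4, h3, h2, h1⟩
  exact (interpolates_or_crossQuot_mem_of_ne hαβ hαγ hαδ hβγ hβδ hγδ ha hb hc hd nac nbc ndb ndc
    hl0 hl1 hl hα hβ hγ hδ).resolve_right hP
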